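/- Let $\Lambda>0$ and let $a,m_e,\omega,k$ be real. Put $\sigma=\Lambda a^2/3$, $\Xi=1+\sigma$, $\widehat k=k+\tfrac12$ and $\Delta_\vartheta=1+\sigma\cos^2\vartheta$. Let $$x(\vartheta)=\int_0^\vartheta\frac{dt}{\sqrt{\Delta_t}}=\frac1{\sqrt\Xi}\int_0^\vartheta\frac{dt}{\sqrt{1-\frac{\sigma}{1+\sigma}\sin^2t}},$$ let $I=(0,x(\pi))$ be the image of $(0,\pi)$ under this strictly increasing coordinate change, and let $\vartheta(x)$, $x\in I$, be its inverse. For $S=(S_1,S_2)$ on $I$ consider the formal differential expression $$\mathcal U S=\begin{pmatrix}-am_e\cos\vartheta(x)&\frac{d}{dx}-q(x)\\-\frac{d}{dx}-q(x)&am_e\cos\vartheta(x)\end{pmatrix}\begin{pmatrix}S_1\\S_2\end{pmatrix},\qquad q(x)=\frac{\Xi}{\sqrt{\Delta_{\vartheta(x)}}}\left[a\omega\sin\vartheta(x)+\frac{\widehat k}{\sin\vartheta(x)}\right].$$ Let $A$ be the operator $AS=\mathcal US$ in the complex Hilbert space $L^2(I,dx)^2$ with the maximal domain $$D(A)=\{S\in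 L^2(I,dx)^2 : S \text{ is absolutely continuous on every compact subinterval of } I,\ \mathcal US\in L^2(I,dx)^2\},$$ and let $A^{\min}$ be the operator $A^{\min}S=\mathcal US$ with domain $C_0^\infty(I)^2$ (complex-valued smooth functions with compact support in the open interval $I$). Then $A$ is self-adjoint if and only if $k\in\mathbb R\setminus(-1,0)$; in particular it is self-adjoint for every integer $k$. Whenever $A$ is self-adjoint, $A^{\min}$ is closable and $A$ is its closure. -/

import Mathlib

noncomputable section

namespace KerrDeSitter

open MeasureTheory Set

/-- `σ = Λ a² / 3`. -/
def sigma (Λ a : ℝ) : ℝ := Λ / 3 * a ^ 2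

/-- `Ξ = 1 + Λ a² / 3`. -/
def Xi (Λ a : ℝ) : ℝ := 1 + sigma Λ a

/-- `Δ_ϑ = 1 + (Λ a² / 3) cos² ϑ`. -/
def DeltaTheta (Λ a ϑ : ℝ) : ℝ := 1 + sigma Λ a * Real.cos ϑ ^ 2

/-- The coordinate change `ϑ ↦ x(ϑ)` with `dx/dϑ = 1/√Δ_ϑ` and `x(0) = 0`; see
`xCoord_eq_elliptic` for its form as an elliptic integral of the first kind. -/
def xCoord (Λ a ϑ : ℝ) : ℝ := ∫ t in (0 : ℝ)..ϑ, 1 / √(DeltaTheta Λ a t)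

/-- The interval `I = (0, x(π))`, which is the image of `(0, π)` under `x` (`xCoord_image`). -/
def I (Λ a : ℝ) : Set ℝ := Ioo 0 (xCoord Λ a Real.pi)

/-- The inverse coordinate change `x ↦ ϑ(x)`, from `I` to `(0, π)`. -/
def thetaOf (Λ a : ℝ) : ℝ → ℝ := Function.invFunOn (xCoord Λ a) (Ioo 0 Real.pi)

section Coordinate

variable {Λ a : ℝ}

theorem sigma_nonneg (hΛ : 0 < Λ) : 0 ≤ sigma Λ a := by unfold sigma; positivity

theorem DeltaTheta_pos (hΛ : 0 < Λ) (ϑ : ℝ) : 0 < DeltaTheta Λ a ϑ := by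
  have := sigma_nonneg (a := a) hΛ
  unfold DeltaTheta; positivity

theorem continuous_DeltaTheta : Continuous (DeltaTheta Λ a) := by
  unfold DeltaTheta; fun_prop

theorem continuous_xDensity (hΛ : 0 < Λ) :
    Continuous fun t => 1 / √(DeltaTheta Λ a t) :=
  continuous_const.div continuous_DeltaTheta.sqrt
    fun t => (Real.sqrt_pos.2 (DeltaTheta_pos hΛ t)).ne'

theorem hasDerivAt_xCoord (hΛ : 0 < Λ) (ϑ : ℝ) :
    HasDerivAt (xCoord Λ a) (1 / √(DeltaTheta Λ a ϑ)) ϑ :=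
  (continuous_xDensity hΛ).integral_hasStrictDerivAt 0 ϑ |>.hasDerivAt

theorem continuous_xCoord (hΛ : 0 < Λ) : Continuous (xCoord Λ a) :=
  continuous_iff_continuousAt.2 fun ϑ => (hasDerivAt_xCoord hΛ ϑ).continuousAt

theorem strictMono_xCoord (hΛ : 0 < Λ) : StrictMono (xCoord Λ a) :=
  strictMono_of_hasDerivAt_pos (hasDerivAt_xCoord hΛ)
    fun ϑ => one_div_pos.2 (Real.sqrt_pos.2 (DeltaTheta_pos hΛ ϑ))

/-- `x(ϑ) = Ξ^{-1/2} ∫₀^ϑ dt / √(1 - κ² sin² t)` with `κ² = σ / (1 + σ)`. -/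
theorem xCoord_eq_elliptic (hΛ : 0 < Λ) (ϑ : ℝ) :
    xCoord Λ a ϑ = 1 / √(Xi Λ a) *
      ∫ t in (0 : ℝ)..ϑ, 1 / √(1 - sigma Λ a / (1 + sigma Λ a) * Real.sin t ^ 2) := by
  have hσ := sigma_nonneg (a := a) hΛ
  have hX : 0 < 1 + sigma Λ a := by positivity
  rw [xCoord, ← intervalIntegral.integral_const_mul]
  congr 1
  funext t
  rw [one_div_mul_one_div, Xi, ← Real.sqrt_mul hX.le]
  congr 2
  rw [DeltaTheta, Real.cos_sq']
  field_simp
  ring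

theorem xCoord_image (hΛ : 0 < Λ) : xCoord Λ a '' Ioo 0 Real.pi = I Λ a := by
  have h0 : xCoord Λ a 0 = 0 := by simp [xCoord]
  apply Subset.antisymm
  · rintro _ ⟨ϑ, hϑ, rfl⟩
    exact ⟨h0 ▸ strictMono_xCoord hΛ hϑ.1, strictMono_xCoord hΛ hϑ.2⟩
  · have := intermediate_value_Ioo Real.pi_pos.le (continuous_xCoord (a := a) hΛ).continuousOn
    rwa [h0] at this

theorem thetaOf_mem (hΛ : 0 < Λ) {x : ℝ} (hx : x ∈ I Λ a) : thetaOf Λ a x ∈ Ioo 0 Real.pi :=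
  Function.invFunOn_mem (by rwa [← xCoord_image hΛ] at hx)

theorem xCoord_thetaOf (hΛ : 0 < Λ) {x : ℝ} (hx : x ∈ I Λ a) : xCoord Λ a (thetaOf Λ a x) = x :=
  Function.invFunOn_eq (by rwa [← xCoord_image hΛ] at hx)

theorem continuousOn_thetaOf (hΛ : 0 < Λ) : ContinuousOn (thetaOf Λ a) (I Λ a) := by
  intro x hx
  have hm := thetaOf_mem hΛ hx
  refine ContinuousAt.continuousWithinAt ?_
  have hmono : StrictMonoOn (thetaOf Λ a) (I Λ a) := by
    intro y hy z hz hyz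
    rw [← (strictMono_xCoord (a := a) hΛ).lt_iff_lt, xCoord_thetaOf hΛ hy, xCoord_thetaOf hΛ hz]
    exact hyz
  refine hmono.continuousAt_of_image_mem_nhds (isOpen_Ioo.mem_nhds hx)
    (Filter.mem_of_superset (isOpen_Ioo.mem_nhds hm) ?_)
  intro ϑ hϑ
  have hxI : xCoord Λ a ϑ ∈ I Λ a := xCoord_image hΛ ▸ mem_image_of_mem _ hϑ
  exact ⟨_, hxI, (strictMono_xCoord hΛ).injective (xCoord_thetaOf hΛ hxI)⟩

end Coordinate

/-- The off-diagonal coefficient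
`(Ξ / √Δ) (a ω sin ϑ(x) + (k + 1/2) / sin ϑ(x))`, with `Δ` evaluated at `ϑ(x)`. -/
def offDiag (Λ a ω k x : ℝ) : ℝ :=
  Xi Λ a / √(DeltaTheta Λ a (thetaOf Λ a x)) *
    (a * ω * Real.sin (thetaOf Λ a x) + (k + 1 / 2) / Real.sin (thetaOf Λ a x))

/-- The diagonal coefficient `a mₑ cos ϑ(x)`. -/
def diag (Λ a mₑ x : ℝ) : ℝ := a * mₑ * Real.cos (thetaOf Λ a x)

/-- First component of `𝒰 (u, v)`. -/
def diracFst (Λ a mₑ ω k : ℝ) (u v : ℝ → ℂ) (x : ℝ) : ℂ :=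
  -(diag Λ a mₑ x : ℂ) * u x + (deriv v x - (offDiag Λ a ω k x : ℂ) * v x)

/-- Second component of `𝒰 (u, v)`. -/
def diracSnd (Λ a mₑ ω k : ℝ) (u v : ℝ → ℂ) (x : ℝ) : ℂ :=
  (-deriv u x - (offDiag Λ a ω k x : ℂ) * u x) + (diag Λ a mₑ x : ℂ) * v x

/-- The complex functions that are absolutely continuous in the set `J`, in the sense of
the theory of singular differential operators: on each compact interval `[c, d] ⊆ J`. -/
def locAC (J : Set ℝ) : Submodule ℂ (ℝ → ℂ) where
  carrier := {u | ∀ c d : ℝ, c ≤ d → Icc c d ⊆ J → AbsolutelyContinuousOnInterval u c d}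
  zero_mem' := fun _ _ _ _ =>
    (contDiff_const (c := (0 : ℂ))).contDiffOn.absolutelyContinuousOnInterval
  add_mem' := fun hu hv c d h hJ => (hu c d h hJ).add (hv c d h hJ)
  smul_mem' := fun α _ hu c d h hJ => (hu c d h hJ).const_smul α

/-- `C₀^∞(J)`: complex smooth functions with compact support contained in `J`. -/
def testFun (J : Set ℝ) : Submodule ℂ (ℝ → ℂ) where
  carrier := {u | ContDiff ℝ ((⊤ : ℕ∞) : WithTop ℕ∞) u ∧ HasCompactSupport u ∧ tsupport u ⊆ J}
  zero_mem' := ⟨contDiff_const, HasCompactSupport.zero, by simp [tsupport]⟩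
  add_mem' := fun hu hv => ⟨hu.1.add hv.1, hu.2.1.add hv.2.1,
    (tsupport_add _ _).trans (union_subset hu.2.2 hv.2.2)⟩
  smul_mem' := fun α _ hu => ⟨hu.1.const_smul α, hu.2.1.smul_left (f := fun _ => α),
    (tsupport_smul_subset_right (fun _ => α) _).trans hu.2.2⟩

theorem testFun_le_locAC (J : Set ℝ) : testFun J ≤ locAC J := fun _ hu _ _ _ _ =>
  (hu.1.of_le (by simp)).contDiffOn.absolutelyContinuousOnInterval

theorem locAC_continuousOn {J : Set ℝ} (hJ : IsOpen J) {u : ℝ → ℂ} (hu : u ∈ locAC J) :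
    ContinuousOn u J := by
  intro x hx
  obtain ⟨ε, hε, hb⟩ := Metric.nhds_basis_closedBall.mem_iff.1 (hJ.mem_nhds hx)
  rw [Real.closedBall_eq_Icc] at hb
  have hle : x - ε ≤ x + ε := by linarith
  have := (hu _ _ hle hb).continuousOn
  rw [uIcc_of_le hle] at this
  exact (this.continuousAt (Icc_mem_nhds (by linarith) (by linarith))).continuousWithinAt

theorem locAC_ae_differentiableAt {α β : ℝ} {u : ℝ → ℂ} (hu : u ∈ locAC (Ioo α β)) :
    ∀ᵐ x ∂(volume.restrict (Ioo α β)), DifferentiableAt ℝ u x := by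
  rw [ae_restrict_iff' measurableSet_Ioo]
  have key : ∀ p : ℚ × ℚ, ∀ᵐ x : ℝ, α < p.1 → (p.2 : ℝ) < β → x ∈ Ioo (p.1 : ℝ) p.2 →
      DifferentiableAt ℝ u x := by
    intro p
    by_cases h : α < p.1 ∧ (p.2 : ℝ) < β ∧ (p.1 : ℝ) ≤ p.2
    · have hac := hu p.1 p.2 h.2.2 fun y hy => ⟨h.1.trans_le hy.1, hy.2.trans_lt h.2.1⟩
      filter_upwards [hac.boundedVariationOn.ae_differentiableAt_of_mem_uIcc] with x hx _ _ hxp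
      exact hx (by rw [uIcc_of_le h.2.2]; exact Ioo_subset_Icc_self hxp)
    · refine Filter.Eventually.of_forall fun x h1 h2 h3 => (h ⟨h1, h2, ?_⟩).elim
      exact (h3.1.trans h3.2).le
  filter_upwards [ae_all_iff.2 key] with x hx hxI
  obtain ⟨p, hp1, hp2⟩ := exists_rat_btwn hxI.1
  obtain ⟨q, hq1, hq2⟩ := exists_rat_btwn hxI.2
  exact hx (p, q) hp1 hq2 ⟨hp2, hq1⟩

/-- The Hilbert space `L²(I, dx)`. -/
abbrev L2I (Λ a : ℝ) : Type := Lp ℂ 2 (volume.restrict (I Λ a))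

/-- The Hilbert space `L²(I, dx)²`, with the Hilbert sum inner product. -/
abbrev L2I2 (Λ a : ℝ) : Type := WithLp 2 (L2I Λ a × L2I Λ a)

section Operators

variable (Λ a mₑ ω k : ℝ)

/-- The graph of the operator `S ↦ 𝒰 S` in `L²(I, dx)²` on the spinors `S = (u, v)` that have
components in the given space `V` of functions and for which `S` and `𝒰 S` are in `L²(I, dx)²`. -/
def diracGraph (V : Submodule ℂ (ℝ → ℂ)) (hV : V ≤ locAC (I Λ a)) :
    Submodule ℂ (L2I2 Λ a × L2I2 Λ a) where
  carrier := {p | ∃ u ∈ V, ∃ v ∈ V,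
    p.1.fst =ᵐ[volume.restrict (I Λ a)] u ∧ p.1.snd =ᵐ[volume.restrict (I Λ a)] v ∧
    p.2.fst =ᵐ[volume.restrict (I Λ a)] diracFst Λ a mₑ ω k u v ∧
    p.2.snd =ᵐ[volume.restrict (I Λ a)] diracSnd Λ a mₑ ω k u v}
  zero_mem' := by
    refine ⟨0, V.zero_mem, 0, V.zero_mem, Lp.coeFn_zero _ _ _, Lp.coeFn_zero _ _ _,
      (Lp.coeFn_zero _ _ _).trans (.of_forall fun x => ?_),
      (Lp.coeFn_zero _ _ _).trans (.of_forall fun x => ?_)⟩ <;>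
    simp [diracFst, diracSnd, show (0 : ℝ → ℂ) = fun _ => 0 from rfl]
  add_mem' := by
    rintro p q ⟨u, hu, v, hv, h1, h2, h3, h4⟩ ⟨u', hu', v', hv', h1', h2', h3', h4'⟩
    have du := locAC_ae_differentiableAt (hV hu)
    have dv := locAC_ae_differentiableAt (hV hv)
    have du' := locAC_ae_differentiableAt (hV hu')
    have dv' := locAC_ae_differentiableAt (hV hv')
    refine ⟨u + u', V.add_mem hu hu', v + v', V.add_mem hv hv', ?_, ?_, ?_, ?_⟩
    · exact (Lp.coeFn_add _ _).trans (h1.add h1')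
    · exact (Lp.coeFn_add _ _).trans (h2.add h2')
    · refine (Lp.coeFn_add p.2.fst q.2.fst).trans ((h3.add h3').trans ?_)
      filter_upwards [dv, dv'] with x e e'
      simp only [diracFst, Pi.add_apply, deriv_add e e']
      ring
    · refine (Lp.coeFn_add p.2.snd q.2.snd).trans ((h4.add h4').trans ?_)
      filter_upwards [du, du'] with x e e'
      simp only [diracSnd, Pi.add_apply, deriv_add e e']
      ring
  smul_mem' := by
    rintro c p ⟨u, hu, v, hv, h1, h2, h3, h4⟩
    refine ⟨c • u, V.smul_mem c hu, c • v, V.smul_mem c hv, ?_, ?_, ?_, ?_⟩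
    · exact (Lp.coeFn_smul c p.1.fst).trans (h1.const_smul c)
    · exact (Lp.coeFn_smul c p.1.snd).trans (h2.const_smul c)
    · refine (Lp.coeFn_smul c p.2.fst).trans ((h3.const_smul c).trans (.of_forall fun x => ?_))
      simp only [diracFst, Pi.smul_apply, deriv_const_smul_field, smul_eq_mul]
      ring
    · refine (Lp.coeFn_smul c p.2.snd).trans ((h4.const_smul c).trans (.of_forall fun x => ?_))
      simp only [diracSnd, Pi.smul_apply, deriv_const_smul_field, smul_eq_mul]
      ring

/-- `𝒰 S` depends on the class of `S` only, so `diracGraph` is the graph of an operator. -/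
theorem diracGraph_functional (V : Submodule ℂ (ℝ → ℂ)) (hV : V ≤ locAC (I Λ a))
    (p : L2I2 Λ a × L2I2 Λ a) (hp : p ∈ diracGraph Λ a mₑ ω k V hV) (h0 : p.1 = 0) :
    p.2 = 0 := by
  obtain ⟨u, hu, v, hv, h1, h2, h3, h4⟩ := hp
  have zero : ∀ {w : ℝ → ℂ}, w ∈ V → (0 : L2I Λ a) =ᵐ[volume.restrict (I Λ a)] w →
      EqOn w 0 (I Λ a) ∧ EqOn (deriv w) 0 (I Λ a) := by
    intro w hw h
    have e : EqOn w 0 (I Λ a) := Measure.eqOn_open_of_ae_eq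
      (h.symm.trans (Lp.coeFn_zero _ _ _)) isOpen_Ioo
      (locAC_continuousOn isOpen_Ioo (hV hw)) continuousOn_const
    refine ⟨e, fun x hx => ?_⟩
    rw [e.deriv isOpen_Ioo hx]
    simp [show (0 : ℝ → ℂ) = fun _ => 0 from rfl]
  rw [h0] at h1 h2
  obtain ⟨eu, edu⟩ := zero hu h1
  obtain ⟨ev, edv⟩ := zero hv h2
  have hI : ∀ᵐ x ∂(volume.restrict (I Λ a)), x ∈ I Λ a := ae_restrict_mem measurableSet_Ioo
  have f3 : p.2.fst = 0 := by
    refine Lp.ext ((h3.trans ?_).trans (Lp.coeFn_zero _ _ _).symm)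
    filter_upwards [hI] with x hx
    simp [diracFst, eu hx, ev hx, edv hx]
  have f4 : p.2.snd = 0 := by
    refine Lp.ext ((h4.trans ?_).trans (Lp.coeFn_zero _ _ _).symm)
    filter_upwards [hI] with x hx
    simp [diracSnd, eu hx, ev hx, edu hx]
  apply WithLp.ofLp_injective
  exact Prod.ext f3 f4

/-- The angular operator `A`: `A S = 𝒰 S` on the maximal domain
`{S ∈ L²(I, dx)² | S absolutely continuous in I, 𝒰 S ∈ L²(I, dx)²}`
(see `mem_angularOp_domain`, `angularOp_apply`). -/
def angularOp : L2I2 Λ a →ₗ.[ℂ] L2I2 Λ a :=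
  (diracGraph Λ a mₑ ω k (locAC (I Λ a)) le_rfl).toLinearPMap

/-- The minimal operator `A^min`: `A^min S = 𝒰 S` on the domain `C₀^∞(I)²`
(see `mem_angularMin_domain`, `angularMin_le_angularOp`). -/
def angularMin : L2I2 Λ a →ₗ.[ℂ] L2I2 Λ a :=
  (diracGraph Λ a mₑ ω k (testFun (I Λ a)) (testFun_le_locAC _)).toLinearPMap

variable {Λ a mₑ ω k}

theorem mem_diracGraph_domain {V : Submodule ℂ (ℝ → ℂ)} {hV : V ≤ locAC (I Λ a)}
    {S : L2I2 Λ a} :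
    S ∈ (diracGraph Λ a mₑ ω k V hV).toLinearPMap.domain ↔ ∃ u ∈ V, ∃ v ∈ V,
      S.fst =ᵐ[volume.restrict (I Λ a)] u ∧ S.snd =ᵐ[volume.restrict (I Λ a)] v ∧
      MemLp (diracFst Λ a mₑ ω k u v) 2 (volume.restrict (I Λ a)) ∧
      MemLp (diracSnd Λ a mₑ ω k u v) 2 (volume.restrict (I Λ a)) := by
  rw [Submodule.toLinearPMap_domain, Submodule.mem_map]
  constructor
  · rintro ⟨p, ⟨u, hu, v, hv, h1, h2, h3, h4⟩, rfl⟩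
    exact ⟨u, hu, v, hv, h1, h2, (memLp_congr_ae h3).1 (Lp.memLp _),
      (memLp_congr_ae h4).1 (Lp.memLp _)⟩
  · rintro ⟨u, hu, v, hv, h1, h2, h3, h4⟩
    exact ⟨(S, WithLp.toLp 2 (h3.toLp _, h4.toLp _)),
      ⟨u, hu, v, hv, h1, h2, h3.coeFn_toLp, h4.coeFn_toLp⟩, rfl⟩

theorem mem_angularOp_domain {S : L2I2 Λ a} :
    S ∈ (angularOp Λ a mₑ ω k).domain ↔
      ∃ u ∈ locAC (I Λ a), ∃ v ∈ locAC (I Λ a),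
        S.fst =ᵐ[volume.restrict (I Λ a)] u ∧ S.snd =ᵐ[volume.restrict (I Λ a)] v ∧
        MemLp (diracFst Λ a mₑ ω k u v) 2 (volume.restrict (I Λ a)) ∧
        MemLp (diracSnd Λ a mₑ ω k u v) 2 (volume.restrict (I Λ a)) :=
  mem_diracGraph_domain

theorem angularOp_apply (S : (angularOp Λ a mₑ ω k).domain) {u v : ℝ → ℂ}
    (hu : u ∈ locAC (I Λ a)) (hv : v ∈ locAC (I Λ a))
    (h1 : (S : L2I2 Λ a).fst =ᵐ[volume.restrict (I Λ a)] u)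
    (h2 : (S : L2I2 Λ a).snd =ᵐ[volume.restrict (I Λ a)] v) :
    (angularOp Λ a mₑ ω k S).fst =ᵐ[volume.restrict (I Λ a)] diracFst Λ a mₑ ω k u v ∧
    (angularOp Λ a mₑ ω k S).snd =ᵐ[volume.restrict (I Λ a)] diracSnd Λ a mₑ ω k u v := by
  obtain ⟨u', hu', v', hv', g1, g2, g3, g4⟩ := Submodule.mem_graph_toLinearPMap
    (diracGraph_functional Λ a mₑ ω k (locAC (I Λ a)) le_rfl) S
  have uniq : ∀ {w w' : ℝ → ℂ}, w ∈ locAC (I Λ a) → w' ∈ locAC (I Λ a) →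
      w =ᵐ[volume.restrict (I Λ a)] w' → EqOn w w' (I Λ a) ∧ EqOn (deriv w) (deriv w') (I Λ a) :=
    fun hw hw' h => by
      have e := Measure.eqOn_open_of_ae_eq h isOpen_Ioo (locAC_continuousOn isOpen_Ioo hw)
        (locAC_continuousOn isOpen_Ioo hw')
      exact ⟨e, e.deriv isOpen_Ioo⟩
  obtain ⟨eu, edu⟩ := uniq hu' hu (g1.symm.trans h1)
  obtain ⟨ev, edv⟩ := uniq hv' hv (g2.symm.trans h2)
  have hI : ∀ᵐ x ∂(volume.restrict (I Λ a)), x ∈ I Λ a := ae_restrict_mem measurableSet_Ioo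
  constructor
  · refine g3.trans ?_
    filter_upwards [hI] with x hx
    simp [diracFst, eu hx, ev hx, edv hx]
  · refine g4.trans ?_
    filter_upwards [hI] with x hx
    simp [diracSnd, eu hx, ev hx, edu hx]

theorem continuousOn_diag (hΛ : 0 < Λ) : ContinuousOn (diag Λ a mₑ) (I Λ a) :=
  continuousOn_const.mul (Real.continuous_cos.comp_continuousOn (continuousOn_thetaOf hΛ))

theorem continuousOn_offDiag (hΛ : 0 < Λ) : ContinuousOn (offDiag Λ a ω k) (I Λ a) := by
  have hθ := continuousOn_thetaOf (a := a) hΛ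
  have hs := Real.continuous_sin.comp_continuousOn hθ
  refine (continuousOn_const.div (continuous_DeltaTheta.sqrt.comp_continuousOn hθ) fun x _ =>
    (Real.sqrt_pos.2 (DeltaTheta_pos hΛ _)).ne').mul
    ((continuousOn_const.mul hs).add (continuousOn_const.div hs fun x hx => ?_))
  exact (Real.sin_pos_of_mem_Ioo (thetaOf_mem hΛ hx)).ne'

theorem memLp_coeff_mul_test {J : Set ℝ} {c : ℝ → ℝ}
    (hc : ContinuousOn c J) {w : ℝ → ℂ} (hw : Continuous w) (hcw : HasCompactSupport w)
    (hwJ : tsupport w ⊆ J) : MemLp (fun x => (c x : ℂ) * w x) 2 (volume.restrict J) := by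
  have hon : ContinuousOn (fun x => (c x : ℂ) * w x) J :=
    (Complex.continuous_ofReal.comp_continuousOn hc).mul hw.continuousOn
  obtain ⟨C, hC⟩ := IsCompact.exists_bound_of_continuousOn hcw (hon.mono hwJ)
  have hsupp : Function.support (fun x => (c x : ℂ) * w x) ⊆ tsupport w := fun x hx =>
    subset_tsupport _ (right_ne_zero_of_mul hx)
  have hK : MeasurableSet (tsupport w) := (isClosed_tsupport w).measurableSet
  have : MemLp (fun x => (c x : ℂ) * w x) 2 (volume.restrict (tsupport w)) := by
    have : IsFiniteMeasure (volume.restrict (tsupport w)) :=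
      ⟨by rw [Measure.restrict_apply_univ]; exact IsCompact.measure_lt_top hcw⟩
    refine MemLp.of_bound ((hon.mono hwJ).aestronglyMeasurable hK) C ?_
    filter_upwards [ae_restrict_mem hK] with x hx using hC x hx
  have h2 := (memLp_indicator_iff_restrict hK).2 this
  rw [indicator_eq_self.2 hsupp] at h2
  exact h2.restrict J

theorem memLp_dirac_test (hΛ : 0 < Λ) {u v : ℝ → ℂ} (hu : u ∈ testFun (I Λ a))
    (hv : v ∈ testFun (I Λ a)) :
    MemLp (diracFst Λ a mₑ ω k u v) 2 (volume.restrict (I Λ a)) ∧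
    MemLp (diracSnd Λ a mₑ ω k u v) 2 (volume.restrict (I Λ a)) := by
  have D : ∀ {w : ℝ → ℂ}, w ∈ testFun (I Λ a) → MemLp (deriv w) 2 (volume.restrict (I Λ a)) :=
    fun hw => ((hw.1.continuous_deriv (by simp)).memLp_of_hasCompactSupport hw.2.1.deriv).restrict _
  have M : ∀ {c : ℝ → ℝ} {w : ℝ → ℂ}, ContinuousOn c (I Λ a) → w ∈ testFun (I Λ a) →
      MemLp (fun x => (c x : ℂ) * w x) 2 (volume.restrict (I Λ a)) :=
    fun hc hw => memLp_coeff_mul_test hc hw.1.continuous hw.2.1 hw.2.2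
  constructor
  · have := (M (continuousOn_diag (mₑ := mₑ) hΛ) hu).neg.add
      ((D hv).sub (M (continuousOn_offDiag (ω := ω) (k := k) hΛ) hv))
    refine (memLp_congr_ae (.of_forall fun x => ?_)).1 this
    simp [diracFst]
  · have := ((D hu).neg.sub (M (continuousOn_offDiag (ω := ω) (k := k) hΛ) hu)).add
      (M (continuousOn_diag (mₑ := mₑ) hΛ) hv)
    refine (memLp_congr_ae (.of_forall fun x => ?_)).1 this
    simp [diracSnd]

/-- The domain of `A^min` is exactly `C₀^∞(I)²`. -/
theorem mem_angularMin_domain (hΛ : 0 < Λ) {S : L2I2 Λ a} :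
    S ∈ (angularMin Λ a mₑ ω k).domain ↔
      ∃ u ∈ testFun (I Λ a), ∃ v ∈ testFun (I Λ a),
        S.fst =ᵐ[volume.restrict (I Λ a)] u ∧ S.snd =ᵐ[volume.restrict (I Λ a)] v := by
  refine mem_diracGraph_domain.trans ⟨?_, ?_⟩
  · rintro ⟨u, hu, v, hv, h1, h2, -⟩
    exact ⟨u, hu, v, hv, h1, h2⟩
  · rintro ⟨u, hu, v, hv, h1, h2⟩
    exact ⟨u, hu, v, hv, h1, h2, memLp_dirac_test hΛ hu hv⟩

theorem angularMin_le_angularOp : angularMin Λ a mₑ ω k ≤ angularOp Λ a mₑ ω k := by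
  apply LinearPMap.le_of_le_graph
  rw [angularMin, angularOp,
    Submodule.toLinearPMap_graph_eq _ (diracGraph_functional Λ a mₑ ω k _ _),
    Submodule.toLinearPMap_graph_eq _ (diracGraph_functional Λ a mₑ ω k _ _)]
  rintro p ⟨u, hu, v, hv, h⟩
  exact ⟨u, testFun_le_locAC _ hu, v, testFun_le_locAC _ hv, h⟩

end Operators

end KerrDeSitter

end

open MeasureTheory Set Filter Topology

/-! ### Absolutely continuous functions -/

/-! The coefficients are real, so Lagrange's identity (`inner_sub_inner_eq`) turns `⟨𝒰S, S'⟩ - ⟨S,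
𝒰S'⟩` into the difference of the endpoint limits of the boundary form `v̄ u' - ū v'`, with `S = (u,
v)` and `S' = (u', v')`. A weak-derivative argument shows that the adjoint of the minimal operator
is the maximal one (`angularMin_adjoint`). Since `A` extends `A^min`, its adjoint is always
contained in `A`; hence `A` is self-adjoint exactly when it is symmetric
(`isSelfAdjoint_angularOp_iff`). In that case `A = A† = (A^min)††`, which is the closure of `A^min`
(`LinearPMap.adjoint_adjoint_eq_closure`).

It remains to examine the endpoints. With `κ = k + 1/2` and `X = x(π)`, the off-diagonal coefficient
is `κ / x + κ / (X - x)` up to a bounded function (`exists_offDiag_bound`), so solutions behave near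
an endpoint like `x ^ (-κ)` and `x ^ κ`.

If `|κ| ≥ 1/2`, one of these powers is not square integrable. Then one component of each domain
element tends to `0` and the other stays bounded, so the boundary form vanishes at both ends
(`IsL2Solution.tendsto_boundary`). If `|κ| < 1/2`, both powers are square integrable, and two
explicit spinors built from them have a nonzero boundary form at `0`
(`not_isSelfAdjoint_angularOp`). The condition `|k + 1/2| < 1/2` is `-1 < k < 0`. -/

theorem LipschitzWith.comp_absolutelyContinuousOnInterval {X Y : Type*} [PseudoMetricSpace X]
    [PseudoMetricSpace Y] {K : NNReal} {g : X → Y} (hg : LipschitzWith K g) {f : ℝ → X} {a b : ℝ}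
    (hf : AbsolutelyContinuousOnInterval f a b) :
    AbsolutelyContinuousOnInterval (fun x => g (f x)) a b := by
  have h := Tendsto.const_mul (K : ℝ) hf
  rw [mul_zero] at h
  refine squeeze_zero (fun E => Finset.sum_nonneg fun i _ => dist_nonneg) (fun E => ?_) h
  rw [Finset.mul_sum]
  exact Finset.sum_le_sum fun i _ => hg.dist_le_mul _ _

theorem AbsolutelyContinuousOnInterval.congr {X : Type*} [PseudoMetricSpace X] {f g : ℝ → X}
    {a b : ℝ} (hf : AbsolutelyContinuousOnInterval f a b) (h : EqOn f g (uIcc a b)) :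
    AbsolutelyContinuousOnInterval g a b := by
  refine Tendsto.congr' ?_ hf
  filter_upwards [mem_inf_of_right (mem_principal_self _)] with E hE
  refine Finset.sum_congr rfl fun i hi => ?_
  rw [h (hE.1 i hi).1, h (hE.1 i hi).2]

theorem IntervalIntegrable.absolutelyContinuousOnInterval_integral_complex {f : ℝ → ℂ}
    {a b c : ℝ} (h : IntervalIntegrable f volume a b) (hc : c ∈ uIcc a b) :
    AbsolutelyContinuousOnInterval (fun x => ∫ t in c..x, f t) a b := by
  have hre : IntervalIntegrable (fun x => (f x).re) volume a b := ⟨h.1.re, h.2.re⟩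
  have him : IntervalIntegrable (fun x => (f x).im) volume a b := ⟨h.1.im, h.2.im⟩
  -- The complex primitive is assembled from the primitives of the real and imaginary parts.
  have e := (Complex.isometry_ofReal.lipschitz.comp_absolutelyContinuousOnInterval
    (hre.absolutelyContinuousOnInterval_intervalIntegral hc)).add
    ((Complex.isometry_ofReal.lipschitz.comp_absolutelyContinuousOnInterval
      (him.absolutelyContinuousOnInterval_intervalIntegral hc)).const_smul Complex.I)
  refine e.congr fun x hx => ?_
  have hx' : IntervalIntegrable f volume c x := h.mono_set (uIcc_subset_uIcc hc hx)
  have h1 := intervalIntegral.intervalIntegral_eq_integral_uIoc f c x volume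
  have h2 := intervalIntegral.intervalIntegral_eq_integral_uIoc (fun t => (f t).re) c x volume
  have h3 := intervalIntegral.intervalIntegral_eq_integral_uIoc (fun t => (f t).im) c x volume
  have h4 := integral_re_add_im (𝕜 := ℂ) (intervalIntegrable_iff.1 hx')
  simp only [Pi.add_apply, h1, h2, h3, ← h4, smul_eq_mul, Complex.real_smul, Complex.ofReal_mul]
  simp only [RCLike.re_to_complex, RCLike.im_to_complex, RCLike.ofReal_eq_complex_ofReal,
    RCLike.I_to_complex]
  ring

/-- Subtracting the primitive of `F` from `f` leaves an absolutely continuous function with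
derivative zero almost everywhere, hence a constant. -/
theorem AbsolutelyContinuousOnInterval.integral_eq_sub_of_ae_hasDerivAt {f F : ℝ → ℂ} {a b : ℝ}
    (hf : AbsolutelyContinuousOnInterval f a b) (hF : IntervalIntegrable F volume a b)
    (h : ∀ᵐ x, x ∈ uIcc a b → HasDerivAt f (F x) x) : ∫ x in a..b, F x = f b - f a := by
  have hG := hf.sub (hF.absolutelyContinuousOnInterval_integral_complex (c := a) left_mem_uIcc)
  obtain ⟨C, hC⟩ := hG.const_of_ae_hasDerivAt_zero <| by
    filter_upwards [h, hF.ae_hasDerivAt_integral] with x h1 h2 hx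
    have := (h1 hx).sub (h2 hx a left_mem_uIcc)
    rwa [sub_self] at this
  have ha := hC a left_mem_uIcc
  have hb := hC b right_mem_uIcc
  simp only [Pi.sub_apply, intervalIntegral.integral_same, sub_zero] at ha hb
  rw [ha, ← hb]; ring

/-! ### Locally absolutely continuous functions and the fundamental theorem on an open interval. -/

namespace KerrDeSitter

theorem mul_mem_locAC {J : Set ℝ} {f g : ℝ → ℂ} (hf : f ∈ locAC J) (hg : g ∈ locAC J) :
    (fun x => f x * g x) ∈ locAC J :=
  fun c d h hJ => (hf c d h hJ).smul (hg c d h hJ)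

theorem conj_mem_locAC {J : Set ℝ} {f : ℝ → ℂ} (hf : f ∈ locAC J) :
    (fun x => star (f x)) ∈ locAC J :=
  fun c d h hJ => Complex.isometry_conj.lipschitz.comp_absolutelyContinuousOnInterval (hf c d h hJ)

theorem contDiffOn_mem_locAC {J : Set ℝ} {f : ℝ → ℂ} (hf : ContDiffOn ℝ 1 f J) : f ∈ locAC J :=
  fun c d h hJ => (hf.mono (by rwa [uIcc_of_le h])).absolutelyContinuousOnInterval

theorem mem_locAC_of_eqOn {J : Set ℝ} {f g : ℝ → ℂ} (hf : f ∈ locAC J) (h : EqOn f g J) :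
    g ∈ locAC J :=
  fun c d hcd hJ => (hf c d hcd hJ).congr (h.mono (by rwa [uIcc_of_le hcd]))

theorem integral_eq_sub_of_locAC {α β : ℝ} {f F : ℝ → ℂ} (hf : f ∈ locAC (Ioo α β))
    (h : ∀ᵐ x ∂volume.restrict (Ioo α β), HasDerivAt f (F x) x)
    {c d : ℝ} (hc : c ∈ Ioo α β) (hd : d ∈ Ioo α β)
    (hF : IntervalIntegrable F volume c d) : ∫ x in c..d, F x = f d - f c := by
  wlog hcd : c ≤ d generalizing c d
  · rw [intervalIntegral.integral_symm, this hd hc hF.symm (le_of_not_ge hcd), neg_sub]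
  have hsub : Icc c d ⊆ Ioo α β := fun x hx => ⟨hc.1.trans_le hx.1, hx.2.trans_lt hd.2⟩
  refine (hf c d hcd hsub).integral_eq_sub_of_ae_hasDerivAt hF ?_
  rw [ae_restrict_iff' measurableSet_Ioo] at h
  filter_upwards [h] with x hx hx'
  exact hx (hsub (by rwa [uIcc_of_le hcd] at hx'))

/-- An integral form of the fundamental theorem of calculus on an open interval, with limits of
the primitive as boundary terms. -/
theorem setIntegral_Ioo_eq_of_tendsto {α β : ℝ} (hαβ : α < β) {f F : ℝ → ℂ}
    (hf : f ∈ locAC (Ioo α β)) (h : ∀ᵐ x ∂volume.restrict (Ioo α β), HasDerivAt f (F x) x)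
    (hF : IntegrableOn F (Ioo α β)) {l r : ℂ} (hl : Tendsto f (𝓝[>] α) (𝓝 l))
    (hr : Tendsto f (𝓝[<] β) (𝓝 r)) : ∫ x in Ioo α β, F x = r - l := by
  have hI : IntervalIntegrable F volume α β :=
    (intervalIntegrable_iff_integrableOn_Ioo_of_le hαβ.le).2 hF
  have hcont := intervalIntegral.continuousOn_primitive_interval
    (show IntegrableOn F (uIcc α β) by
      rwa [uIcc_of_le hαβ.le, integrableOn_Icc_iff_integrableOn_Ioo])
  rw [uIcc_of_le hαβ.le] at hcont
  obtain ⟨m, hm⟩ := nonempty_Ioo.2 hαβ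
  -- `G` is continuous up to both endpoints because `F` is integrable. As `f - G` is constant
  -- inside, `f` has endpoint limits, which must be `l` and `r`.
  set G : ℝ → ℂ := fun x => ∫ t in α..x, F t with hG
  have key : ∀ x ∈ Ioo α β, f x = f m - G m + G x := by
    intro x hx
    have i1 : IntervalIntegrable F volume α m := hI.mono_set (by
      rw [uIcc_of_le hm.1.le, uIcc_of_le hαβ.le]; exact Icc_subset_Icc_right hm.2.le)
    have i2 : IntervalIntegrable F volume α x := hI.mono_set (by
      rw [uIcc_of_le hx.1.le, uIcc_of_le hαβ.le]; exact Icc_subset_Icc_right hx.2.le)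
    have := integral_eq_sub_of_locAC hf h hm hx (i1.symm.trans i2)
    rw [← intervalIntegral.integral_interval_sub_left i2 i1] at this
    linear_combination -this
  have tl : Tendsto f (𝓝[>] α) (𝓝 (f m - G m + G α)) := by
    have : Tendsto G (𝓝[>] α) (𝓝 (G α)) :=
      (hcont α (left_mem_Icc.2 hαβ.le)).mono_left (by
        rw [← nhdsWithin_Ioo_eq_nhdsGT hαβ]; exact nhdsWithin_mono _ Ioo_subset_Icc_self)
    refine (this.const_add _).congr' ?_
    filter_upwards [Ioo_mem_nhdsGT hαβ] with x hx using (key x hx).symm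
  have tr : Tendsto f (𝓝[<] β) (𝓝 (f m - G m + G β)) := by
    have : Tendsto G (𝓝[<] β) (𝓝 (G β)) :=
      (hcont β (right_mem_Icc.2 hαβ.le)).mono_left (by
        rw [← nhdsWithin_Ioo_eq_nhdsLT hαβ]; exact nhdsWithin_mono _ Ioo_subset_Icc_self)
    refine (this.const_add _).congr' ?_
    filter_upwards [Ioo_mem_nhdsLT hαβ] with x hx using (key x hx).symm
  rw [tendsto_nhds_unique hl tl, tendsto_nhds_unique hr tr, ← integral_Ioc_eq_integral_Ioo,
    ← intervalIntegral.integral_of_le hαβ.le]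
  simp [hG]

end KerrDeSitter

/-! ### Double adjoint and closure. -/

section AdjointAdjoint

open LinearPMap

variable {𝕜 E F : Type*} [RCLike 𝕜] [NormedAddCommGroup E] [InnerProductSpace 𝕜 E]
  [NormedAddCommGroup F] [InnerProductSpace 𝕜 F] [CompleteSpace E] [CompleteSpace F]

theorem LinearPMap.le_adjoint_adjoint {T : E →ₗ.[𝕜] F} (hT : Dense (T.domain : Set E))
    (hT' : Dense (T†.domain : Set F)) : T ≤ T†† :=
  (adjoint_isFormalAdjoint hT).le_adjoint hT'

theorem LinearPMap.isClosable_of_dense_adjoint {T : E →ₗ.[𝕜] F}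
    (hT : Dense (T.domain : Set E)) (hT' : Dense (T†.domain : Set F)) : T.IsClosable :=
  (adjoint_isClosed hT').isClosable.leIsClosable (le_adjoint_adjoint hT hT')

/-- For a densely defined operator with a densely defined adjoint, the double adjoint is the
closure. -/
theorem LinearPMap.adjoint_adjoint_eq_closure {T : E →ₗ.[𝕜] F}
    (hT : Dense (T.domain : Set E)) (hT' : Dense (T†.domain : Set F)) :
    T†† = T.closure := by
  apply eq_of_eq_graph
  rw [← (isClosable_of_dense_adjoint hT hT').graph_closure_eq_closure_graph]
  apply le_antisymm
  · intro p hp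
    -- The graph is moved to the Hilbert sum, where orthogonal complements make sense. There the
    -- complement of the graph of `T` is the graph of `T†` rotated by `(w₁, w₂) ↦ (w₂, -w₁)`, so the
    -- graph of `T††` lies in the double complement, which is the closure.
    set e := (WithLp.linearEquiv 2 𝕜 (E × F)).symm with he
    set M : Submodule 𝕜 (WithLp 2 (E × F)) := T.graph.map (e : E × F →ₗ[𝕜] _) with hM
    have h1 : e p ∈ Mᗮᗮ := by
      rw [Submodule.mem_orthogonal]
      intro w hw
      rw [Submodule.mem_orthogonal] at hw
      have h2 : (w.snd, -w.fst) ∈ T†.graph := by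
        rw [adjoint_graph_eq_graph_adjoint hT, Submodule.mem_adjoint_iff]
        intro s t hst
        have := hw _ (Submodule.mem_map_of_mem hst)
        rw [WithLp.prod_inner_apply] at this
        simp only [inner_neg_right, sub_neg_eq_add]
        rw [add_comm]
        exact this
      rw [adjoint_graph_eq_graph_adjoint hT', Submodule.mem_adjoint_iff] at hp
      have := hp _ _ h2
      rw [WithLp.prod_inner_apply]
      simp only [inner_neg_left] at this
      have h3 : inner 𝕜 w.fst p.1 + inner 𝕜 w.snd p.2 = 0 := by
        linear_combination -this
      exact h3
    rw [Submodule.orthogonal_orthogonal_eq_closure] at h1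
    have h4 : e p ∈ _root_.closure (M : Set _) := h1
    rw [hM, Submodule.map_coe] at h4
    have h5 : p ∈ _root_.closure ((T.graph : Set (E × F))) := by
      have := image_closure_subset_closure_image (WithLp.prod_continuous_ofLp 2 E F)
        (mem_image_of_mem _ h4)
      rw [image_image] at this
      simpa [he] using this
    exact h5
  · exact Submodule.topologicalClosure_minimal _ (le_graph_of_le (le_adjoint_adjoint hT hT'))
      (adjoint_isClosed hT')

end AdjointAdjoint

/-! ### Weak derivatives on an interval. -/

namespace KerrDeSitter

theorem integrableOn_smul_of_hasCompactSupport {J : Set ℝ} {f : ℝ → ℂ}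
    (hf : LocallyIntegrableOn f J) {g : ℝ → ℝ} (hg : Continuous g) (hgc : HasCompactSupport g)
    (hgt : tsupport g ⊆ J) : IntegrableOn (fun x => g x • f x) J := by
  obtain ⟨C, hC⟩ := hgc.exists_bound_of_continuous hg
  have h1 := Integrable.bdd_smul (hf.integrableOn_compact_subset hgt hgc) C
    hg.aestronglyMeasurable (.of_forall hC)
  refine ((integrableOn_iff_integrable_of_support_subset (s := tsupport g) fun x hx => ?_).1
    h1).integrableOn
  exact subset_tsupport _ (left_ne_zero_of_smul (a := g x) (b := f x) hx)

/-- **The du Bois-Reymond lemma.** A function on an interval that is orthogonal to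
the derivatives of the test functions is constant almost everywhere. -/
theorem exists_ae_eq_const_of_integral_deriv_mul_eq_zero {α β : ℝ} (hαβ : α < β) {f : ℝ → ℂ}
    (hf : LocallyIntegrableOn f (Ioo α β))
    (h : ∀ g : ℝ → ℝ, ContDiff ℝ (⊤ : ℕ∞) g → HasCompactSupport g → tsupport g ⊆ Ioo α β →
      ∫ x in Ioo α β, deriv g x • f x = 0) :
    ∃ c : ℂ, ∀ᵐ x ∂volume.restrict (Ioo α β), f x = c := by
  obtain ⟨m, hm⟩ := nonempty_Ioo.2 hαβ
  obtain ⟨ε, hε, hb⟩ := Metric.isOpen_iff.1 isOpen_Ioo m hm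
  let b : ContDiffBump m := ⟨ε / 4, ε / 2, by positivity, by linarith⟩
  set ψ : ℝ → ℝ := b.normed volume with hψ
  have ψs : ContDiff ℝ (⊤ : ℕ∞) ψ := b.contDiff_normed
  have ψc : HasCompactSupport ψ := b.hasCompactSupport_normed
  have ψt : tsupport ψ ⊆ Ioo α β := by
    rw [hψ, b.tsupport_normed_eq]
    exact (Metric.closedBall_subset_ball (by change ε / 2 < ε; linarith)).trans hb
  have ψ1 : ∫ x, ψ x = 1 := b.integral_normed
  have mulint := fun (g : ℝ → ℝ) hg hgc hgt => integrableOn_smul_of_hasCompactSupport (g := g)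
    hf hg hgc hgt
  refine ⟨∫ x in Ioo α β, ψ x • f x, ?_⟩
  -- The constant is the average of `f` against a bump of mass one; subtracting `t • ψ` from a test
  -- function of mass `t` makes its mean zero.
  set c := ∫ x in Ioo α β, ψ x • f x with hc
  have := isOpen_Ioo.ae_eq_zero_of_integral_contDiff_smul_eq_zero (U := Ioo α β)
    (μ := volume.restrict (Ioo α β)) (f := fun x => f x - c)
    ((hf.sub (locallyIntegrableOn_const c)).mono_measure Measure.restrict_le_self) (by
      intro g gs gc gt
      -- the zero-mean part of `g` is the derivative of a test function
      set t : ℝ := ∫ x, g x with ht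
      set φ : ℝ → ℝ := fun x => g x - t * ψ x with hφ
      have φs : ContDiff ℝ (⊤ : ℕ∞) φ := gs.sub (contDiff_const.mul ψs)
      have gint : Integrable g := gs.continuous.integrable_of_hasCompactSupport gc
      have ψint : Integrable ψ := ψs.continuous.integrable_of_hasCompactSupport ψc
      have φi : Integrable φ := gint.sub (ψint.const_mul t)
      have φ0 : ∫ x, φ x = 0 := by
        rw [hφ, integral_sub gint (ψint.const_mul t), integral_const_mul, ψ1]; simp [ht]
      set K := tsupport g ∪ tsupport ψ with hK
      have hKc : IsCompact K := gc.isCompact.union ψc.isCompact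
      have hKs : K ⊆ Ioo α β := union_subset gt ψt
      have φK : ∀ x, x ∉ K → φ x = 0 := by
        intro x hx
        rw [hK, mem_union, not_or] at hx
        simp [hφ, image_eq_zero_of_notMem_tsupport hx.1, image_eq_zero_of_notMem_tsupport hx.2]
      obtain ⟨p, q, hp, hq, hpq⟩ : ∃ p q, α < p ∧ q < β ∧ K ⊆ Icc p q := by
        have hne : K.Nonempty := by
          by_contra hne
          rw [not_nonempty_iff_eq_empty] at hne
          have : ψ = 0 := by
            rw [← tsupport_eq_empty_iff]; exact subset_eq_empty subset_union_right hne
          simp [this] at ψ1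
        obtain ⟨p, hp⟩ := hKc.exists_isLeast hne
        obtain ⟨q, hq⟩ := hKc.exists_isGreatest hne
        exact ⟨p, q, (hKs hp.1).1, (hKs hq.1).2, fun x hx => ⟨hp.2 hx, hq.2 hx⟩⟩
      set η : ℝ → ℝ := fun x => ∫ s in p..x, φ s with hη
      have ηd : ∀ x, HasDerivAt η (φ x) x := fun x =>
        (φs.continuous.integral_hasStrictDerivAt p x).hasDerivAt
      have ηderiv : deriv η = φ := funext fun x => (ηd x).deriv
      have ηs : ContDiff ℝ (⊤ : ℕ∞) η := by
        refine contDiff_infty_iff_deriv.2 ⟨fun x => (ηd x).differentiableAt, ?_⟩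
        rw [ηderiv]; exact φs
      -- To the left of `K` nothing has been integrated yet; to the right the full integral of `φ`
      -- is zero. Hence the primitive has compact support.
      have ηz : ∀ x, x ∉ Icc p q → η x = 0 := by
        intro x hx
        rw [mem_Icc, not_and_or, not_le, not_le] at hx
        rcases hx with hx | hx
        · rw [hη]
          refine intervalIntegral.integral_zero_ae ?_
          -- The endpoint `p` may belong to `K`; it is discarded as a null set.
          filter_upwards [compl_mem_ae_iff.2 (measure_singleton p)] with s hs hs'
          rw [uIoc_of_ge hx.le] at hs'
          exact φK s fun hsK => hs (le_antisymm hs'.2 (hpq hsK).1)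
        · by_cases hpx : p ≤ x
          · rw [hη]
            simp only
            rw [intervalIntegral.integral_of_le hpx, ← integral_Icc_eq_integral_Ioc,
              setIntegral_eq_integral_of_forall_compl_eq_zero, φ0]
            intro s hs
            exact φK s fun hsK => hs ⟨(hpq hsK).1, (hpq hsK).2.trans hx.le⟩
          · rw [hη]
            refine intervalIntegral.integral_zero_ae (.of_forall fun s hs' => ?_)
            rw [uIoc_of_ge (not_le.1 hpx).le] at hs'
            exact φK s fun hsK => absurd (hpq hsK).2 (not_le.2 (hx.trans hs'.1))
      have ηsupp : tsupport η ⊆ Icc p q :=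
        closure_minimal (fun x hx => by_contra fun h' => hx (ηz x h')) isClosed_Icc
      have key := h η ηs (HasCompactSupport.of_support_subset_isCompact isCompact_Icc
        ((subset_tsupport _).trans ηsupp))
        (ηsupp.trans fun x hx => ⟨hp.trans_le hx.1, hx.2.trans_lt hq⟩)
      rw [ηderiv] at key
      have e1 : ∫ x in Ioo α β, φ x • f x = (∫ x in Ioo α β, g x • f x) - (t : ℂ) * c := by
        rw [hc, ← integral_const_mul, ← integral_sub (mulint g gs.continuous gc gt)
          ((mulint ψ ψs.continuous ψc ψt).const_mul _)]
        refine integral_congr_ae (.of_forall fun x => ?_)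
        simp only [hφ, Complex.real_smul, Complex.ofReal_sub, Complex.ofReal_mul]
        ring
      have e2 : ∫ x in Ioo α β, g x • c = (t : ℂ) * c := by
        rw [integral_smul_const, setIntegral_eq_integral_of_forall_compl_eq_zero,
          Complex.real_smul]
        intro x hx
        exact image_eq_zero_of_notMem_tsupport fun hx' => hx (gt hx')
      have hgc : IntegrableOn (fun x => g x • c) (Ioo α β) := (gint.smul_const c).integrableOn
      simp only [smul_sub]
      rw [integral_sub (mulint g gs.continuous gc gt) hgc, e2, ← e1, key])
  rw [ae_restrict_iff' measurableSet_Ioo] at this ⊢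
  filter_upwards [this] with x hx hx'
  exact sub_eq_zero.1 (hx hx' hx')

theorem tendsto_zero_of_tsupport_subset_Ioo {α β : ℝ} {E : Type*} [NormedAddCommGroup E]
    {g : ℝ → E} (hg : tsupport g ⊆ Ioo α β) :
    (∀ᶠ x in 𝓝[>] α, g x = 0) ∧ ∀ᶠ x in 𝓝[<] β, g x = 0 := by
  have key : ∀ y, y ∉ Ioo α β → ∀ s : Set ℝ, ∀ᶠ x in 𝓝[s] y, g x = 0 := fun y hy s => by
    have : (tsupport g)ᶜ ∈ 𝓝 y :=
      (isClosed_tsupport g).isOpen_compl.mem_nhds fun h => hy (hg h)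
    filter_upwards [mem_nhdsWithin_of_mem_nhds this] with x hx
    exact image_eq_zero_of_notMem_tsupport hx
  exact ⟨key α (by simp) _, key β (by simp) _⟩

theorem intervalIntegrable_of_locallyIntegrableOn_Ioo {α β : ℝ} {g : ℝ → ℂ}
    (hg : LocallyIntegrableOn g (Ioo α β)) {c d : ℝ} (hc : c ∈ Ioo α β) (hd : d ∈ Ioo α β) :
    IntervalIntegrable g volume c d :=
  (hg.integrableOn_compact_subset (ordConnected_Ioo.uIcc_subset hc hd)
    isCompact_uIcc).intervalIntegrable

theorem primitive_mem_locAC {α β m : ℝ} (hm : m ∈ Ioo α β) {g : ℝ → ℂ}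
    (hg : LocallyIntegrableOn g (Ioo α β)) : (fun x => ∫ t in m..x, g t) ∈ locAC (Ioo α β) := by
  intro c d hcd hJ
  have hc : c ∈ Ioo α β := hJ (left_mem_Icc.2 hcd)
  have hd : d ∈ Ioo α β := hJ (right_mem_Icc.2 hcd)
  -- The interval is enlarged so that it contains the base point `m`.
  have h1 : min c m ∈ Ioo α β := by rcases min_choice c m with h | h <;> rwa [h]
  have h2 : max d m ∈ Ioo α β := by rcases max_choice d m with h | h <;> rwa [h]
  have hle : min c m ≤ max d m := (min_le_left _ _).trans (hcd.trans (le_max_left _ _))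
  refine ((intervalIntegrable_of_locallyIntegrableOn_Ioo hg h1
    h2).absolutelyContinuousOnInterval_integral_complex (c := m) ?_).mono ?_
  · rw [uIcc_of_le hle]; exact ⟨min_le_right _ _, le_max_right _ _⟩
  · rw [uIcc_of_le hle, uIcc_of_le hcd]
    exact Icc_subset_Icc (min_le_left _ _) (le_max_left _ _)

/-- Lebesgue differentiation applies on compact subintervals; countably many of them, with rational
ends on either side of the base point, exhaust the interval. -/
theorem ae_hasDerivAt_primitive {α β m : ℝ} (hm : m ∈ Ioo α β) {g : ℝ → ℂ}
    (hg : LocallyIntegrableOn g (Ioo α β)) :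
    ∀ᵐ x ∂volume.restrict (Ioo α β), HasDerivAt (fun x => ∫ t in m..x, g t) (g x) x := by
  rw [ae_restrict_iff' measurableSet_Ioo]
  have key : ∀ p : ℚ × ℚ, ∀ᵐ x : ℝ, (p.1 : ℝ) ∈ Ioo α m → (p.2 : ℝ) ∈ Ioo m β →
      x ∈ Ioo (p.1 : ℝ) p.2 → HasDerivAt (fun x => ∫ t in m..x, g t) (g x) x := by
    intro p
    by_cases h : (p.1 : ℝ) ∈ Ioo α m ∧ (p.2 : ℝ) ∈ Ioo m β
    · have h1 : (p.1 : ℝ) ∈ Ioo α β := ⟨h.1.1, h.1.2.trans hm.2⟩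
      have h2 : (p.2 : ℝ) ∈ Ioo α β := ⟨hm.1.trans h.2.1, h.2.2⟩
      have hle : (p.1 : ℝ) ≤ p.2 := (h.1.2.trans h.2.1).le
      filter_upwards [(intervalIntegrable_of_locallyIntegrableOn_Ioo hg h1
        h2).ae_hasDerivAt_integral] with x hx _ _ hxp
      rw [uIcc_of_le hle] at hx
      exact hx (Ioo_subset_Icc_self hxp) m ⟨h.1.2.le, h.2.1.le⟩
    · exact Filter.Eventually.of_forall fun x h1 h2 _ => (h ⟨h1, h2⟩).elim
  filter_upwards [ae_all_iff.2 key] with x hx hxI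
  obtain ⟨p, hp1, hp2⟩ := exists_rat_btwn (show α < min x m from lt_min hxI.1 hm.1)
  obtain ⟨q, hq1, hq2⟩ := exists_rat_btwn (show max x m < β from max_lt hxI.2 hm.2)
  exact hx (p, q) ⟨hp1, hp2.trans_le (min_le_right _ _)⟩ ⟨(le_max_right _ _).trans_lt hq1, hq2⟩
    ⟨hp2.trans_le (min_le_left _ _), (le_max_left _ _).trans_lt hq1⟩

/-- A locally integrable function with a locally integrable weak derivative is
almost everywhere equal to a locally absolutely continuous function. -/
theorem exists_locAC_of_weak_deriv {α β : ℝ} (hαβ : α < β) {f g : ℝ → ℂ}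
    (hf : LocallyIntegrableOn f (Ioo α β)) (hg : LocallyIntegrableOn g (Ioo α β))
    (h : ∀ φ : ℝ → ℝ, ContDiff ℝ (⊤ : ℕ∞) φ → HasCompactSupport φ → tsupport φ ⊆ Ioo α β →
      ∫ x in Ioo α β, deriv φ x • f x = -∫ x in Ioo α β, φ x • g x) :
    ∃ w ∈ locAC (Ioo α β), f =ᵐ[volume.restrict (Ioo α β)] w ∧
      ∀ᵐ x ∂volume.restrict (Ioo α β), HasDerivAt w (g x) x := by
  obtain ⟨m, hm⟩ := nonempty_Ioo.2 hαβ
  set W : ℝ → ℂ := fun x => ∫ t in m..x, g t with hW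
  have hWAC : W ∈ locAC (Ioo α β) := primitive_mem_locAC hm hg
  have hWd : ∀ᵐ x ∂volume.restrict (Ioo α β), HasDerivAt W (g x) x := ae_hasDerivAt_primitive hm hg
  have hWint : LocallyIntegrableOn W (Ioo α β) :=
    (locAC_continuousOn isOpen_Ioo hWAC).locallyIntegrableOn measurableSet_Ioo
  -- The primitive `W` of `g` has the same weak derivative as `f`, so the du Bois-Reymond lemma
  -- applies to `f - W`.
  have parts : ∀ φ : ℝ → ℝ, ContDiff ℝ (⊤ : ℕ∞) φ → HasCompactSupport φ →
      tsupport φ ⊆ Ioo α β →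
      ∫ x in Ioo α β, deriv φ x • W x = -∫ x in Ioo α β, φ x • g x := by
    intro φ φs φc φt
    have dφt : tsupport (deriv φ) ⊆ Ioo α β := tsupport_deriv_subset.trans φt
    have i1 := integrableOn_smul_of_hasCompactSupport hWint (φs.continuous_deriv (by simp))
      φc.deriv dφt
    have i2 := integrableOn_smul_of_hasCompactSupport hg φs.continuous φc φt
    have φAC : (fun x => (φ x : ℂ)) ∈ locAC (Ioo α β) :=
      contDiffOn_mem_locAC ((Complex.ofRealCLM.contDiff.comp φs).of_le (by simp)).contDiffOn
    obtain ⟨z1, z2⟩ := tendsto_zero_of_tsupport_subset_Ioo φt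
    have := setIntegral_Ioo_eq_of_tendsto (l := 0) (r := 0) hαβ (mul_mem_locAC φAC hWAC)
      (F := fun x => deriv φ x • W x + φ x • g x) ?_ (i1.add i2) ?_ ?_
    · rw [integral_add i1 i2, sub_zero] at this
      exact eq_neg_of_add_eq_zero_left this
    · filter_upwards [hWd] with x hx
      have hφ : HasDerivAt (fun x => (φ x : ℂ)) ((deriv φ x : ℝ) : ℂ) x :=
        ((φs.differentiable (by simp)) x).hasDerivAt.ofReal_comp
      exact hφ.mul hx
    · exact tendsto_const_nhds.congr' (by filter_upwards [z1] with x hx; simp [hx])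
    · exact tendsto_const_nhds.congr' (by filter_upwards [z2] with x hx; simp [hx])
  obtain ⟨c, hc⟩ := exists_ae_eq_const_of_integral_deriv_mul_eq_zero hαβ (hf.sub hWint) (by
    intro φ φs φc φt
    have dφt : tsupport (deriv φ) ⊆ Ioo α β := tsupport_deriv_subset.trans φt
    have dφ := φs.continuous_deriv (by simp)
    simp only [Pi.sub_apply, smul_sub]
    rw [integral_sub (integrableOn_smul_of_hasCompactSupport hf dφ φc.deriv dφt)
      (integrableOn_smul_of_hasCompactSupport hWint dφ φc.deriv dφt), h φ φs φc φt,
      parts φ φs φc φt, sub_self])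
  refine ⟨fun x => W x + c, (locAC _).add_mem hWAC (contDiffOn_mem_locAC contDiffOn_const), ?_, ?_⟩
  · filter_upwards [hc] with x hx
    rw [← hx]; simp
  · filter_upwards [hWd] with x hx using hx.add_const c

/-! ### Lagrange's identity, the adjoint of the minimal operator, and the symmetry criterion. -/

variable {Λ a mₑ ω k : ℝ}

theorem xCoord_pi_pos (hΛ : 0 < Λ) : 0 < xCoord Λ a Real.pi := by
  have h0 : xCoord Λ a 0 = 0 := by simp [xCoord]
  exact h0 ▸ strictMono_xCoord hΛ Real.pi_pos

/-- The functions `u, v` represent the point `p = (S, 𝒰 S)` with `S = (u, v)`. -/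
def IsRep (Λ a mₑ ω k : ℝ) (p : L2I2 Λ a × L2I2 Λ a) (u v : ℝ → ℂ) : Prop :=
  p.1.fst =ᵐ[volume.restrict (I Λ a)] u ∧ p.1.snd =ᵐ[volume.restrict (I Λ a)] v ∧
    p.2.fst =ᵐ[volume.restrict (I Λ a)] diracFst Λ a mₑ ω k u v ∧
    p.2.snd =ᵐ[volume.restrict (I Λ a)] diracSnd Λ a mₑ ω k u v

theorem exists_isRep {u v : ℝ → ℂ} (hu : MemLp u 2 (volume.restrict (I Λ a)))
    (hv : MemLp v 2 (volume.restrict (I Λ a)))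
    (h1 : MemLp (diracFst Λ a mₑ ω k u v) 2 (volume.restrict (I Λ a)))
    (h2 : MemLp (diracSnd Λ a mₑ ω k u v) 2 (volume.restrict (I Λ a))) :
    ∃ p, IsRep Λ a mₑ ω k p u v :=
  ⟨(WithLp.toLp 2 (hu.toLp _, hv.toLp _), WithLp.toLp 2 (h1.toLp _, h2.toLp _)),
    hu.coeFn_toLp, hv.coeFn_toLp, h1.coeFn_toLp, h2.coeFn_toLp⟩

theorem inner_eq_integral {P Q : L2I2 Λ a} {p₁ p₂ q₁ q₂ : ℝ → ℂ}
    (h₁ : P.fst =ᵐ[volume.restrict (I Λ a)] p₁) (h₂ : P.snd =ᵐ[volume.restrict (I Λ a)] p₂)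
    (g₁ : Q.fst =ᵐ[volume.restrict (I Λ a)] q₁) (g₂ : Q.snd =ᵐ[volume.restrict (I Λ a)] q₂) :
    IntegrableOn (fun x => star (p₁ x) * q₁ x + star (p₂ x) * q₂ x) (I Λ a) ∧
    inner ℂ P Q = ∫ x in I Λ a, (star (p₁ x) * q₁ x + star (p₂ x) * q₂ x) := by
  have e : (fun x => inner ℂ (P.fst x) (Q.fst x) + inner ℂ (P.snd x) (Q.snd x))
      =ᵐ[volume.restrict (I Λ a)] fun x => star (p₁ x) * q₁ x + star (p₂ x) * q₂ x := by
    filter_upwards [h₁, h₂, g₁, g₂] with x e1 e2 e3 e4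
    rw [e1, e2, e3, e4, RCLike.inner_apply, RCLike.inner_apply, mul_comm, mul_comm (q₂ x)]
    rfl
  have i1 := L2.integrable_inner (𝕜 := ℂ) P.fst Q.fst
  have i2 := L2.integrable_inner (𝕜 := ℂ) P.snd Q.snd
  refine ⟨(i1.add i2).congr e, ?_⟩
  rw [← integral_congr_ae e, integral_add i1 i2, WithLp.prod_inner_apply, ← L2.inner_def,
    ← L2.inner_def]
  rfl

/-- **Lagrange's identity** for `𝒰`. -/
theorem inner_sub_inner_eq (hΛ : 0 < Λ) {p p' : L2I2 Λ a × L2I2 Λ a} {u v u' v' : ℝ → ℂ}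
    (hu : u ∈ locAC (I Λ a)) (hv : v ∈ locAC (I Λ a))
    (hu' : u' ∈ locAC (I Λ a)) (hv' : v' ∈ locAC (I Λ a))
    (hp : IsRep Λ a mₑ ω k p u v) (hp' : IsRep Λ a mₑ ω k p' u' v') {l r : ℂ}
    (hl : Tendsto (fun x => star (v x) * u' x - star (u x) * v' x) (𝓝[>] 0) (𝓝 l))
    (hr : Tendsto (fun x => star (v x) * u' x - star (u x) * v' x)
      (𝓝[<] (xCoord Λ a Real.pi)) (𝓝 r)) :
    inner ℂ p.2 p'.1 - inner ℂ p.1 p'.2 = r - l := by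
  obtain ⟨i1, e1⟩ := inner_eq_integral hp.2.2.1 hp.2.2.2 hp'.1 hp'.2.1
  obtain ⟨i2, e2⟩ := inner_eq_integral hp.1 hp.2.1 hp'.2.2.1 hp'.2.2.2
  rw [e1, e2, ← integral_sub i1 i2]
  refine setIntegral_Ioo_eq_of_tendsto (xCoord_pi_pos hΛ)
    ((locAC _).sub_mem (mul_mem_locAC (conj_mem_locAC hv) hu')
      (mul_mem_locAC (conj_mem_locAC hu) hv')) ?_ (i1.sub i2) hl hr
  filter_upwards [locAC_ae_differentiableAt hu, locAC_ae_differentiableAt hv,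
    locAC_ae_differentiableAt hu', locAC_ae_differentiableAt hv'] with x du dv du' dv'
  have h := ((dv.hasDerivAt.star).mul du'.hasDerivAt).sub ((du.hasDerivAt.star).mul dv'.hasDerivAt)
  refine h.congr_deriv ?_
  -- The coefficients are real, so all terms without a derivative cancel.
  simp only [Pi.sub_apply, diracFst, diracSnd, star_add, star_sub, star_neg, star_mul',
    Complex.star_def, Complex.conj_ofReal]
  ring

theorem test_boundary {u v u' v' : ℝ → ℂ} (hu : u ∈ testFun (I Λ a)) (hv : v ∈ testFun (I Λ a)) :
    Tendsto (fun x => star (v x) * u' x - star (u x) * v' x) (𝓝[>] 0) (𝓝 0) ∧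
    Tendsto (fun x => star (v x) * u' x - star (u x) * v' x)
      (𝓝[<] (xCoord Λ a Real.pi)) (𝓝 0) := by
  obtain ⟨u1, u2⟩ := tendsto_zero_of_tsupport_subset_Ioo hu.2.2
  obtain ⟨v1, v2⟩ := tendsto_zero_of_tsupport_subset_Ioo hv.2.2
  constructor
  · exact tendsto_const_nhds.congr' (by filter_upwards [u1, v1] with x h1 h2; simp [h1, h2])
  · exact tendsto_const_nhds.congr' (by filter_upwards [u2, v2] with x h1 h2; simp [h1, h2])

theorem ofReal_mem_testFun {J : Set ℝ} {φ : ℝ → ℝ} (φs : ContDiff ℝ (⊤ : ℕ∞) φ)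
    (φc : HasCompactSupport φ) (φt : tsupport φ ⊆ J) : (fun x => (φ x : ℂ)) ∈ testFun J :=
  ⟨Complex.ofRealCLM.contDiff.comp φs, φc.comp_left (g := Complex.ofReal) Complex.ofReal_zero,
    (closure_mono fun x hx => by simpa using hx).trans φt⟩

theorem exists_isRep_test (hΛ : 0 < Λ) (mₑ ω k : ℝ) {u v : ℝ → ℂ} (hu : u ∈ testFun (I Λ a))
    (hv : v ∈ testFun (I Λ a)) :
    ∃ p ∈ diracGraph Λ a mₑ ω k (testFun (I Λ a)) (testFun_le_locAC _),
      IsRep Λ a mₑ ω k p u v := by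
  obtain ⟨h1, h2⟩ := memLp_dirac_test (mₑ := mₑ) (ω := ω) (k := k) hΛ hu hv
  have M : ∀ {w : ℝ → ℂ}, w ∈ testFun (I Λ a) → MemLp w 2 (volume.restrict (I Λ a)) :=
    fun hw => (hw.1.continuous.memLp_of_hasCompactSupport hw.2.1).restrict _
  obtain ⟨p, hp⟩ := exists_isRep (M hu) (M hv) h1 h2
  exact ⟨p, ⟨u, hu, v, hv, hp⟩, hp⟩

theorem locallyIntegrableOn_coe (w : L2I Λ a) : LocallyIntegrableOn w (I Λ a) := by
  have : IsFiniteMeasure (volume.restrict (I Λ a)) := by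
    unfold I; infer_instance
  exact IntegrableOn.locallyIntegrableOn ((Lp.memLp w).integrable (by norm_num))

theorem locallyIntegrableOn_ofReal_mul {J : Set ℝ} (hJ : IsOpen J) {c : ℝ → ℝ}
    (hc : ContinuousOn c J) {w : ℝ → ℂ} (hw : LocallyIntegrableOn w J) :
    LocallyIntegrableOn (fun x => (c x : ℂ) * w x) J := by
  rw [locallyIntegrableOn_iff hJ.isLocallyClosed] at hw ⊢
  intro K hK hKc
  exact (hw K hK hKc).continuousOn_mul
    (Complex.continuous_ofReal.comp_continuousOn (hc.mono hK)) hKc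

/-- A vector orthogonal to the domain is tested with real test functions placed in one component at
a time, which forces each component to vanish. -/
theorem dense_angularMin_domain (hΛ : 0 < Λ) :
    Dense ((angularMin Λ a mₑ ω k).domain : Set (L2I2 Λ a)) := by
  rw [Submodule.dense_iff_topologicalClosure_eq_top, Submodule.topologicalClosure_eq_top_iff,
    Submodule.eq_bot_iff]
  intro P hP
  rw [Submodule.mem_orthogonal] at hP
  have key : ∀ u ∈ testFun (I Λ a), ∀ v ∈ testFun (I Λ a),
      ∫ x in I Λ a, (star (u x) * P.fst x + star (v x) * P.snd x) = 0 := by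
    intro u hu v hv
    obtain ⟨p, hp, hr⟩ := exists_isRep_test hΛ mₑ ω k hu hv
    rw [← (inner_eq_integral hr.1 hr.2.1 .rfl .rfl).2]
    exact hP _ ((mem_angularMin_domain hΛ).2 ⟨u, hu, v, hv, hr.1, hr.2.1⟩)
  have z : ∀ w : L2I Λ a, (∀ φ : ℝ → ℝ, ContDiff ℝ (⊤ : ℕ∞) φ → HasCompactSupport φ →
      tsupport φ ⊆ I Λ a → ∫ x in I Λ a, φ x • w x = 0) → w = 0 := by
    intro w hw
    refine Lp.ext (EventuallyEq.trans ?_ (Lp.coeFn_zero _ _ _).symm)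
    have := isOpen_Ioo.ae_eq_zero_of_integral_contDiff_smul_eq_zero (U := I Λ a)
      ((locallyIntegrableOn_coe w).mono_measure Measure.restrict_le_self) hw
    filter_upwards [this, ae_restrict_mem measurableSet_Ioo] with x h1 h2 using h1 h2
  apply WithLp.ofLp_injective
  refine Prod.ext (z _ fun φ φs φc φt => ?_) (z _ fun φ φs φc φt => ?_)
  · simpa using key _ (ofReal_mem_testFun φs φc φt) 0 (Submodule.zero_mem _)
  · simpa using key 0 (Submodule.zero_mem _) _ (ofReal_mem_testFun φs φc φt)

theorem angularOp_graph : (angularOp Λ a mₑ ω k).graph =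
    diracGraph Λ a mₑ ω k (locAC (I Λ a)) le_rfl :=
  Submodule.toLinearPMap_graph_eq _ (diracGraph_functional Λ a mₑ ω k _ _)

theorem angularMin_graph : (angularMin Λ a mₑ ω k).graph =
    diracGraph Λ a mₑ ω k (testFun (I Λ a)) (testFun_le_locAC _) :=
  Submodule.toLinearPMap_graph_eq _ (diracGraph_functional Λ a mₑ ω k _ _)

/-- The adjoint of the minimal operator is the maximal operator. -/
theorem angularMin_adjoint (hΛ : 0 < Λ) :
    (angularMin Λ a mₑ ω k).adjoint = angularOp Λ a mₑ ω k := by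
  apply LinearPMap.eq_of_eq_graph
  rw [LinearPMap.adjoint_graph_eq_graph_adjoint (dense_angularMin_domain hΛ), angularOp_graph,
    angularMin_graph]
  ext p
  rw [Submodule.mem_adjoint_iff]
  constructor
  · intro h
    have hX := xCoord_pi_pos (a := a) hΛ
    have ld := continuousOn_diag (a := a) (mₑ := mₑ) hΛ
    have lq := continuousOn_offDiag (a := a) (ω := ω) (k := k) hΛ
    have l11 := locallyIntegrableOn_coe p.1.fst
    have l12 := locallyIntegrableOn_coe p.1.snd
    have l21 := locallyIntegrableOn_coe p.2.fst
    have l22 := locallyIntegrableOn_coe p.2.snd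
    have m : ∀ {c : ℝ → ℝ} {w : ℝ → ℂ}, ContinuousOn c (I Λ a) → LocallyIntegrableOn w (I Λ a) →
        LocallyIntegrableOn (fun x => (c x : ℂ) * w x) (I Λ a) :=
      fun hc hw => locallyIntegrableOn_ofReal_mul isOpen_Ioo hc hw
    -- These are the candidate weak derivatives of the second and first components, obtained by
    -- solving `p.2 = 𝒰 p.1` for `v'` and `u'`.
    have lg1 : LocallyIntegrableOn (fun x => p.2.fst x + (diag Λ a mₑ x : ℂ) * p.1.fst x +
        (offDiag Λ a ω k x : ℂ) * p.1.snd x) (I Λ a) := (l21.add (m ld l11)).add (m lq l12)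
    have lg2 : LocallyIntegrableOn (fun x => -p.2.snd x - (offDiag Λ a ω k x : ℂ) * p.1.fst x +
        (diag Λ a mₑ x : ℂ) * p.1.snd x) (I Λ a) := (l22.neg.sub (m lq l11)).add (m ld l12)
    have pair : ∀ u ∈ testFun (I Λ a), ∀ v ∈ testFun (I Λ a),
        ∫ x in I Λ a, ((star (diracFst Λ a mₑ ω k u v x) * p.1.fst x +
          star (diracSnd Λ a mₑ ω k u v x) * p.1.snd x) -
          (star (u x) * p.2.fst x + star (v x) * p.2.snd x)) = 0 := by
      intro u hu v hv
      obtain ⟨q, hq, hr⟩ := exists_isRep_test hΛ mₑ ω k hu hv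
      obtain ⟨i1, e1⟩ := inner_eq_integral (Q := p.1) hr.2.2.1 hr.2.2.2 .rfl .rfl
      obtain ⟨i2, e2⟩ := inner_eq_integral (Q := p.2) hr.1 hr.2.1 .rfl .rfl
      rw [integral_sub i1 i2, ← e1, ← e2]
      exact h _ _ hq
    have dφ : ∀ {φ : ℝ → ℝ} (x : ℝ), ContDiff ℝ (⊤ : ℕ∞) φ →
        deriv (fun x => (φ x : ℂ)) x = ((deriv φ x : ℝ) : ℂ) := fun x φs =>
      (((φs.differentiable (by simp)) x).hasDerivAt.ofReal_comp).deriv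
    -- Testing with `(φ, 0)` isolates the weak equation of the second component; testing with `(0,
    -- φ)` below isolates that of the first.
    obtain ⟨v, hv, ev, dv⟩ := exists_locAC_of_weak_deriv hX l12 lg1 (by
      intro φ φs φc φt
      have := pair _ (ofReal_mem_testFun φs φc φt) 0 (Submodule.zero_mem _)
      have i1 := integrableOn_smul_of_hasCompactSupport l12 (φs.continuous_deriv (by simp))
        φc.deriv (tsupport_deriv_subset.trans φt)
      have i2 := integrableOn_smul_of_hasCompactSupport lg1 φs.continuous φc φt
      rw [← add_eq_zero_iff_eq_neg]
      refine Eq.trans (integral_add i1 i2).symm ?_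
      rw [← neg_zero, ← this, ← integral_neg]
      refine integral_congr_ae (.of_forall fun x => ?_)
      simp only [diracFst, diracSnd, dφ x φs, Pi.zero_apply, Complex.real_smul,
        show deriv (0 : ℝ → ℂ) x = 0 from deriv_const x 0, star_add, star_sub, star_neg, star_mul',
        Complex.star_def, Complex.conj_ofReal, map_zero]
      ring)
    obtain ⟨u, hu, eu, du⟩ := exists_locAC_of_weak_deriv hX l11 lg2 (by
      intro φ φs φc φt
      have := pair 0 (Submodule.zero_mem _) _ (ofReal_mem_testFun φs φc φt)
      have i1 := integrableOn_smul_of_hasCompactSupport l11 (φs.continuous_deriv (by simp))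
        φc.deriv (tsupport_deriv_subset.trans φt)
      have i2 := integrableOn_smul_of_hasCompactSupport lg2 φs.continuous φc φt
      rw [← add_eq_zero_iff_eq_neg]
      refine Eq.trans (integral_add i1 i2).symm ?_
      rw [← this]
      refine integral_congr_ae (.of_forall fun x => ?_)
      simp only [diracFst, diracSnd, dφ x φs, Pi.zero_apply, Complex.real_smul,
        show deriv (0 : ℝ → ℂ) x = 0 from deriv_const x 0, star_add, star_sub, star_neg, star_mul',
        Complex.star_def, Complex.conj_ofReal, map_zero]
      ring)
    refine ⟨u, hu, v, hv, eu, ev, ?_, ?_⟩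
    · filter_upwards [eu, ev, dv] with x h1 h2 h3
      rw [diracFst, h3.deriv, ← h1, ← h2]; ring
    · filter_upwards [eu, ev, du] with x h1 h2 h3
      rw [diracSnd, h3.deriv, ← h1, ← h2]; ring
  -- Conversely, the compact support of the test spinor removes both boundary terms of Lagrange's
  -- identity.
  · rintro ⟨u', hu', v', hv', hp⟩ s t ⟨u, hu, v, hv, hst⟩
    obtain ⟨b1, b2⟩ := test_boundary (u' := u') (v' := v') hu hv
    rw [inner_sub_inner_eq (p := (s, t)) hΛ (testFun_le_locAC _ hu) (testFun_le_locAC _ hv) hu' hv'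
      hst hp b1 b2, sub_zero]

theorem dense_angularOp_domain (hΛ : 0 < Λ) :
    Dense ((angularOp Λ a mₑ ω k).domain : Set (L2I2 Λ a)) :=
  (dense_angularMin_domain hΛ).mono angularMin_le_angularOp.1

/-- Only symmetry is at stake: `A^min ≤ A` reverses under adjoints to `A† ≤ (A^min)† = A`, so the
inclusion `A† ≤ A` is automatic. -/
theorem isSelfAdjoint_angularOp_iff (hΛ : 0 < Λ) :
    IsSelfAdjoint (angularOp Λ a mₑ ω k) ↔
      ∀ p ∈ diracGraph Λ a mₑ ω k (locAC (I Λ a)) le_rfl,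
      ∀ q ∈ diracGraph Λ a mₑ ω k (locAC (I Λ a)) le_rfl,
        inner ℂ p.2 q.1 - inner ℂ p.1 q.2 = 0 := by
  have hd := dense_angularOp_domain (a := a) (mₑ := mₑ) (ω := ω) (k := k) hΛ
  rw [LinearPMap.isSelfAdjoint_def]
  constructor
  · intro h p hp q hq
    rw [← angularOp_graph, ← h, LinearPMap.adjoint_graph_eq_graph_adjoint hd, angularOp_graph,
      Submodule.mem_adjoint_iff] at hq
    exact hq p.1 p.2 hp
  · intro h
    apply LinearPMap.eq_of_eq_graph
    apply le_antisymm
    · rw [LinearPMap.adjoint_graph_eq_graph_adjoint hd]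
      intro q hq
      have : q ∈ (angularMin Λ a mₑ ω k).adjoint.graph := by
        rw [LinearPMap.adjoint_graph_eq_graph_adjoint (dense_angularMin_domain hΛ)]
        rw [Submodule.mem_adjoint_iff] at hq ⊢
        exact fun s t hst => hq s t (LinearPMap.le_graph_of_le angularMin_le_angularOp hst)
      rwa [angularMin_adjoint hΛ] at this
    · rw [LinearPMap.adjoint_graph_eq_graph_adjoint hd, angularOp_graph]
      intro q hq
      rw [Submodule.mem_adjoint_iff]
      exact fun s t hst => h _ hst q hq

/-- The closure of `A^min` is its double adjoint, that is the adjoint of `A`, which is `A` itself.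
-/
theorem closure_angularMin (hΛ : 0 < Λ) (h : IsSelfAdjoint (angularOp Λ a mₑ ω k)) :
    (angularMin Λ a mₑ ω k).IsClosable ∧
      angularOp Λ a mₑ ω k = (angularMin Λ a mₑ ω k).closure := by
  have hd := dense_angularMin_domain (a := a) (mₑ := mₑ) (ω := ω) (k := k) hΛ
  have hd' : Dense ((angularMin Λ a mₑ ω k).adjoint.domain : Set (L2I2 Λ a)) := by
    rw [angularMin_adjoint hΛ]; exact dense_angularOp_domain hΛ
  refine ⟨LinearPMap.isClosable_of_dense_adjoint hd hd', ?_⟩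
  rw [← LinearPMap.adjoint_adjoint_eq_closure hd hd', angularMin_adjoint hΛ]
  exact (LinearPMap.isSelfAdjoint_def.1 h).symm

/-! ### Poles of the off-diagonal coefficient. -/

theorem DeltaTheta_pi_sub (ϑ : ℝ) : DeltaTheta Λ a (Real.pi - ϑ) = DeltaTheta Λ a ϑ := by
  simp [DeltaTheta, Real.cos_pi_sub]

theorem one_le_DeltaTheta (hΛ : 0 < Λ) (ϑ : ℝ) : 1 ≤ DeltaTheta Λ a ϑ := by
  have := sigma_nonneg (a := a) hΛ
  unfold DeltaTheta
  nlinarith [sq_nonneg (Real.cos ϑ)]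

theorem one_le_sqrt_DeltaTheta (hΛ : 0 < Λ) (ϑ : ℝ) : 1 ≤ √(DeltaTheta Λ a ϑ) :=
  Real.one_le_sqrt.2 (one_le_DeltaTheta hΛ ϑ)

theorem Xi_pos (hΛ : 0 < Λ) : 0 < Xi Λ a := by
  have := sigma_nonneg (a := a) hΛ
  unfold Xi; positivity

/-- Substituting `t ↦ π - t` preserves the density. This symmetry reduces the endpoint `x(π)` to the
endpoint `0`. -/
theorem xCoord_pi_sub (hΛ : 0 < Λ) (ϑ : ℝ) :
    xCoord Λ a (Real.pi - ϑ) = xCoord Λ a Real.pi - xCoord Λ a ϑ := by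
  have hi : ∀ s t, IntervalIntegrable (fun t => 1 / √(DeltaTheta Λ a t)) volume s t :=
    fun s t => (continuous_xDensity hΛ).intervalIntegrable s t
  unfold xCoord
  rw [intervalIntegral.integral_interval_sub_left (hi _ _) (hi _ _)]
  have := intervalIntegral.integral_comp_sub_left (a := 0) (b := Real.pi - ϑ)
    (fun t => 1 / √(DeltaTheta Λ a t)) Real.pi
  simp only [DeltaTheta_pi_sub, sub_sub_cancel, sub_zero] at this
  exact this

theorem xCoord_pos (hΛ : 0 < Λ) {ϑ : ℝ} (hϑ : 0 < ϑ) : 0 < xCoord Λ a ϑ := by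
  have h0 : xCoord Λ a 0 = 0 := by simp [xCoord]
  exact h0 ▸ strictMono_xCoord hΛ hϑ

/-- The differentiated function is the numerator of `Ξ / (√Δ sin ϑ) - 1 / x`. The factor `1 - cos ϑ`
shows that this numerator vanishes to third order at `0`. -/
theorem hasDerivAt_Xi_mul_xCoord_sub (hΛ : 0 < Λ) (ϑ : ℝ) :
    HasDerivAt (fun t => Xi Λ a * xCoord Λ a t - √(DeltaTheta Λ a t) * Real.sin t)
      ((1 - Real.cos ϑ) * (1 + sigma Λ a * (2 * Real.cos ϑ ^ 2 + 2 * Real.cos ϑ + 1)) /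
        √(DeltaTheta Λ a ϑ)) ϑ := by
  have hD := DeltaTheta_pos (a := a) hΛ ϑ
  have hs := Real.sqrt_pos.2 hD
  have h1 : HasDerivAt (DeltaTheta Λ a)
      (sigma Λ a * (2 * Real.cos ϑ * -Real.sin ϑ)) ϑ := by
    have := (((Real.hasDerivAt_cos ϑ).pow 2).const_mul (sigma Λ a)).const_add 1
    exact this.congr_deriv (by simp)
  have h := ((hasDerivAt_xCoord (a := a) hΛ ϑ).const_mul (Xi Λ a)).sub
    ((h1.sqrt hD.ne').mul (Real.hasDerivAt_sin ϑ))
  refine h.congr_deriv ?_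
  field_simp
  rw [Real.sq_sqrt hD.le, Xi, DeltaTheta]
  have := Real.sin_sq_add_cos_sq ϑ
  linear_combination (sigma Λ a * Real.cos ϑ) * this

/-- Both bounds compare derivatives, starting from the value `0` at `0`. The `5` is the maximum of
`2c² + 2c + 1` for `c ∈ [-1, 1]`, and `1 - cos t ≤ t² / 2` leaves room to spare against `3t²`. -/
theorem Xi_mul_xCoord_sub_bounds (hΛ : 0 < Λ) {ϑ : ℝ} (hϑ : 0 ≤ ϑ) :
    0 ≤ Xi Λ a * xCoord Λ a ϑ - √(DeltaTheta Λ a ϑ) * Real.sin ϑ ∧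
    Xi Λ a * xCoord Λ a ϑ - √(DeltaTheta Λ a ϑ) * Real.sin ϑ ≤
      (1 + 5 * sigma Λ a) * ϑ ^ 3 := by
  have hσ := sigma_nonneg (a := a) hΛ
  set h : ℝ → ℝ := fun t => Xi Λ a * xCoord Λ a t - √(DeltaTheta Λ a t) * Real.sin t with hh
  have hd := hasDerivAt_Xi_mul_xCoord_sub (a := a) hΛ
  have h0 : h 0 = 0 := by simp [hh, xCoord]
  have hnum : ∀ t : ℝ, 0 ≤ 1 + sigma Λ a * (2 * Real.cos t ^ 2 + 2 * Real.cos t + 1) := fun t => by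
    have : 0 ≤ 2 * Real.cos t ^ 2 + 2 * Real.cos t + 1 := by
      nlinarith [sq_nonneg (Real.cos t + 1), sq_nonneg (Real.cos t)]
    positivity
  have hc : ∀ t : ℝ, 0 ≤ 1 - Real.cos t := fun t => sub_nonneg.2 (Real.cos_le_one t)
  constructor
  · have : Monotone h := monotone_of_hasDerivAt_nonneg hd
      fun t => div_nonneg (mul_nonneg (hc t) (hnum t)) (Real.sqrt_nonneg _)
    exact h0 ▸ this hϑ
  · have hmono : Monotone fun t => (1 + 5 * sigma Λ a) * t ^ 3 - h t := by
      refine monotone_of_hasDerivAt_nonneg (fun t => ((hasDerivAt_pow 3 t).const_mul _).sub (hd t))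
        fun t => ?_
      have hs := one_le_sqrt_DeltaTheta (a := a) hΛ t
      have e1 : (1 - Real.cos t) * (1 + sigma Λ a * (2 * Real.cos t ^ 2 + 2 * Real.cos t + 1)) /
          √(DeltaTheta Λ a t) ≤
          (1 - Real.cos t) * (1 + sigma Λ a * (2 * Real.cos t ^ 2 + 2 * Real.cos t + 1)) :=
        div_le_self (mul_nonneg (hc t) (hnum t)) hs
      have e2 : 1 + sigma Λ a * (2 * Real.cos t ^ 2 + 2 * Real.cos t + 1) ≤ 1 + 5 * sigma Λ a := by
        have : 2 * Real.cos t ^ 2 + 2 * Real.cos t + 1 ≤ 5 := by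
          nlinarith [Real.cos_le_one t, Real.cos_sq_le_one t]
        nlinarith
      have e3 : 1 - Real.cos t ≤ t ^ 2 / 2 := by linarith [Real.one_sub_sq_div_two_le_cos (x := t)]
      have e4 := mul_le_mul e3 e2 (hnum t) (by positivity)
      have e5 : 0 ≤ (1 + 5 * sigma Λ a) * t ^ 2 := by positivity
      simp only [Pi.zero_apply]
      norm_num
      linarith
    have := hmono hϑ
    simp only [h0] at this
    norm_num at this
    exact this

/-- Over a common denominator the numerator is at most `(1 + 5σ) ϑ³`, while the denominator is at
least `ϑ² / (4Ξ)`. The remaining factor `4ϑ` is at most `8` because `ϑ ≤ 2`. -/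
theorem abs_Xi_div_sub_inv_le (hΛ : 0 < Λ) {ϑ : ℝ} (hϑ : ϑ ∈ Ioc 0 (Real.pi / 2)) :
    |Xi Λ a / (√(DeltaTheta Λ a ϑ) * Real.sin ϑ) - 1 / xCoord Λ a ϑ| ≤
      (1 + 5 * sigma Λ a) * (Xi Λ a * 8) := by
  have hσ := sigma_nonneg (a := a) hΛ
  have hΞ := Xi_pos (a := a) hΛ
  obtain ⟨b0, b1⟩ := Xi_mul_xCoord_sub_bounds (a := a) hΛ hϑ.1.le
  have hx := xCoord_pos (a := a) hΛ hϑ.1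
  have hs := one_le_sqrt_DeltaTheta (a := a) hΛ ϑ
  have hsin : ϑ / 2 ≤ Real.sin ϑ := by
    refine le_trans ?_ (Real.mul_le_sin hϑ.1.le hϑ.2)
    have : 1 / 2 ≤ 2 / Real.pi := by
      rw [div_le_div_iff₀ (by norm_num) Real.pi_pos]; linarith [Real.pi_le_four]
    nlinarith [hϑ.1]
  have hϑ0 := hϑ.1
  have hsin0 : 0 < Real.sin ϑ := by linarith
  have hp : Real.sin ϑ ≤ √(DeltaTheta Λ a ϑ) * Real.sin ϑ := by nlinarith
  have hX : ϑ / 2 ≤ Xi Λ a * xCoord Λ a ϑ := by linarith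
  rw [show Xi Λ a / (√(DeltaTheta Λ a ϑ) * Real.sin ϑ) - 1 / xCoord Λ a ϑ =
    (Xi Λ a * xCoord Λ a ϑ - √(DeltaTheta Λ a ϑ) * Real.sin ϑ) /
      (√(DeltaTheta Λ a ϑ) * Real.sin ϑ * xCoord Λ a ϑ) by field_simp,
    abs_of_nonneg (by positivity), div_le_iff₀ (by positivity)]
  have e1 : ϑ / 2 * (ϑ / 2) ≤ √(DeltaTheta Λ a ϑ) * Real.sin ϑ * (Xi Λ a * xCoord Λ a ϑ) :=
    mul_le_mul (by linarith) hX (by positivity) (by positivity)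
  have hϑ2 : ϑ ≤ 2 := by linarith [hϑ.2, Real.pi_le_four]
  calc _ ≤ (1 + 5 * sigma Λ a) * ϑ ^ 3 := b1
    _ ≤ (1 + 5 * sigma Λ a) * (8 * (ϑ / 2 * (ϑ / 2))) := by
        gcongr; nlinarith [sq_nonneg ϑ]
    _ ≤ (1 + 5 * sigma Λ a) *
        (8 * (√(DeltaTheta Λ a ϑ) * Real.sin ϑ * (Xi Λ a * xCoord Λ a ϑ))) := by gcongr
    _ = _ := by ring

/-- The off-diagonal coefficient differs from its two pole terms by a bounded function. -/
theorem exists_offDiag_bound (hΛ : 0 < Λ) (a ω k : ℝ) : ∃ C, ∀ x ∈ I Λ a,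
    |offDiag Λ a ω k x - ((k + 1 / 2) / x + (k + 1 / 2) / (xCoord Λ a Real.pi - x))| ≤ C := by
  set C₀ := (1 + 5 * sigma Λ a) * (Xi Λ a * 8) with hC₀
  set d := xCoord Λ a (Real.pi / 2) with hd
  have hd0 : 0 < d := xCoord_pos hΛ (by positivity)
  have hΞ := Xi_pos (a := a) hΛ
  -- On the left half only the pole at `0` matters: the other pole term is at most `1 / d`. The
  -- right half follows by reflection.
  have half : ∀ ϑ ∈ Ioc 0 (Real.pi / 2),
      |Xi Λ a / (√(DeltaTheta Λ a ϑ) * Real.sin ϑ) -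
        (1 / xCoord Λ a ϑ + 1 / xCoord Λ a (Real.pi - ϑ))| ≤ C₀ + 1 / d := by
    intro ϑ hϑ
    have h1 := abs_Xi_div_sub_inv_le (a := a) hΛ hϑ
    have h2 : d ≤ xCoord Λ a (Real.pi - ϑ) := (strictMono_xCoord hΛ).monotone (by linarith [hϑ.2])
    have h3 : |1 / xCoord Λ a (Real.pi - ϑ)| ≤ 1 / d := by
      rw [abs_of_pos (one_div_pos.2 (hd0.trans_le h2))]
      exact one_div_le_one_div_of_le hd0 h2
    rw [← sub_sub]
    exact (abs_sub _ _).trans (add_le_add h1 h3)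
  have full : ∀ ϑ ∈ Ioo 0 Real.pi,
      |Xi Λ a / (√(DeltaTheta Λ a ϑ) * Real.sin ϑ) -
        (1 / xCoord Λ a ϑ + 1 / xCoord Λ a (Real.pi - ϑ))| ≤ C₀ + 1 / d := by
    intro ϑ hϑ
    rcases le_total ϑ (Real.pi / 2) with h | h
    · exact half ϑ ⟨hϑ.1, h⟩
    · have := half (Real.pi - ϑ) ⟨by linarith [hϑ.2], by linarith⟩
      rwa [DeltaTheta_pi_sub, Real.sin_pi_sub, sub_sub_cancel,
        add_comm (1 / xCoord Λ a (Real.pi - ϑ))] at this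
  refine ⟨Xi Λ a * |a * ω| + |k + 1 / 2| * (C₀ + 1 / d), fun x hx => ?_⟩
  have hm := thetaOf_mem hΛ hx
  have hxe := xCoord_thetaOf hΛ hx
  set ϑ := thetaOf Λ a x with hϑ
  have hf := full ϑ hm
  rw [xCoord_pi_sub hΛ, hxe] at hf
  have hs := one_le_sqrt_DeltaTheta (a := a) hΛ ϑ
  have hsin := Real.sin_pos_of_mem_Ioo hm
  have e : offDiag Λ a ω k x - ((k + 1 / 2) / x + (k + 1 / 2) / (xCoord Λ a Real.pi - x)) =
      Xi Λ a / √(DeltaTheta Λ a ϑ) * Real.sin ϑ * (a * ω) +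
      (k + 1 / 2) * (Xi Λ a / (√(DeltaTheta Λ a ϑ) * Real.sin ϑ) -
        (1 / x + 1 / (xCoord Λ a Real.pi - x))) := by
    rw [offDiag, ← hϑ, div_mul_eq_div_div]
    ring
  rw [e]
  refine (abs_add_le _ _).trans (add_le_add ?_ ?_)
  · rw [abs_mul]
    refine mul_le_mul_of_nonneg_right ?_ (abs_nonneg _)
    rw [abs_of_nonneg (by positivity)]
    calc _ ≤ Xi Λ a * 1 := mul_le_mul (div_le_self hΞ.le hs) (Real.sin_le_one _) hsin.le hΞ.le
      _ = _ := mul_one _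
  · rw [abs_mul]
    exact mul_le_mul_of_nonneg_left hf (abs_nonneg _)

/-! ### The singular endpoint and the limit point case. -/

theorem contDiffOn_rpow_ofReal {s β : ℝ} :
    ContDiffOn ℝ 1 (fun x : ℝ => ((x ^ s : ℝ) : ℂ)) (Ioo 0 β) := fun x hx =>
  (Complex.ofRealCLM.contDiff.contDiffAt.comp x
    (Real.contDiffAt_rpow_const_of_ne (n := 1) (p := s) hx.1.ne')).contDiffWithinAt

/-- The power is an integrating factor: taking `s = ±κ` cancels the singular term `∓(κ / x) u` of
the equation. -/
theorem hasDerivAt_rpow_mul {s x : ℝ} (hx : 0 < x) {u : ℝ → ℂ} {u' : ℂ} (hu : HasDerivAt u u' x) :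
    HasDerivAt (fun x : ℝ => ((x ^ s : ℝ) : ℂ) * u x)
      (((x ^ s : ℝ) : ℂ) * (u' + ((s / x : ℝ) : ℂ) * u x)) x := by
  have h := ((Real.hasDerivAt_rpow_const (p := s) (Or.inl hx.ne')).ofReal_comp).mul hu
  refine h.congr_deriv ?_
  have : s * x ^ (s - 1) = x ^ s * (s / x) := by rw [Real.rpow_sub_one hx.ne']; ring
  rw [this]
  push_cast
  ring

/-- Solutions of `u' = -(κ / x) u + F` with `κ ≥ 1/2` and square integrable `u` and `F`
vanish at the singular endpoint. -/
theorem tendsto_zero_of_half_le {β κ : ℝ} (hβ : 0 < β) (hκ : 1 / 2 ≤ κ) {u F : ℝ → ℂ}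
    (hu : u ∈ locAC (Ioo 0 β)) (hu2 : MemLp u 2 (volume.restrict (Ioo 0 β)))
    (hF : MemLp F 2 (volume.restrict (Ioo 0 β)))
    (h : ∀ᵐ x ∂volume.restrict (Ioo 0 β), HasDerivAt u (-((κ / x : ℝ) : ℂ) * u x + F x) x) :
    Tendsto u (𝓝[>] 0) (𝓝 0) := by
  have hκ0 : 0 < κ := by linarith
  have hFi : IntegrableOn F (Ioo 0 β) := hF.integrable (by norm_num)
  have hFI : IntervalIntegrable F volume 0 β :=
    (intervalIntegrable_iff_integrableOn_Ioo_of_le hβ.le).2 hFi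
  have hcont : Continuous fun x : ℝ => ((x ^ κ : ℝ) : ℂ) :=
    Complex.continuous_ofReal.comp (Real.continuous_rpow_const hκ0.le)
  have hGI : IntervalIntegrable (fun x => ((x ^ κ : ℝ) : ℂ) * F x) volume 0 β :=
    hFI.continuousOn_mul hcont.continuousOn
  set N : ℝ → ℝ := fun x => ∫ t in (0 : ℝ)..x, ‖F t‖ with hN
  set W : ℝ → ℂ := fun x => ∫ t in (0 : ℝ)..x, ((t ^ κ : ℝ) : ℂ) * F t with hW
  have sub : ∀ x ∈ Ioo 0 β, uIcc 0 x ⊆ uIcc 0 β := fun x hx => by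
    rw [uIcc_of_le hx.1.le, uIcc_of_le hβ.le]; exact Icc_subset_Icc_right hx.2.le
  have hWN : ∀ x ∈ Ioo 0 β, ‖W x‖ ≤ x ^ κ * N x := by
    intro x hx
    rw [hN, ← intervalIntegral.integral_const_mul]
    refine intervalIntegral.norm_integral_le_of_norm_le hx.1.le (.of_forall fun t ht => ?_)
      ((hFI.mono_set (sub x hx)).norm.const_mul _)
    rw [norm_mul, Complex.norm_real, Real.norm_of_nonneg (Real.rpow_nonneg ht.1.le _)]
    exact mul_le_mul_of_nonneg_right (Real.rpow_le_rpow ht.1.le ht.2 hκ0.le) (norm_nonneg _)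
  have hNmono : ∀ x ∈ Ioo 0 β, N x ≤ N β := fun x hx =>
    intervalIntegral.integral_mono_interval le_rfl hx.1.le hx.2.le
      (.of_forall fun t => norm_nonneg _) hFI.norm
  have hN0 : Tendsto N (𝓝[>] 0) (𝓝 0) := by
    have hc := intervalIntegral.continuousOn_primitive_interval
      (show IntegrableOn (fun t => ‖F t‖) (uIcc 0 β) by
        rw [uIcc_of_le hβ.le, integrableOn_Icc_iff_integrableOn_Ioo]; exact hFi.norm)
    rw [uIcc_of_le hβ.le] at hc
    have : Tendsto N (𝓝[>] 0) (𝓝 (N 0)) :=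
      (hc 0 (left_mem_Icc.2 hβ.le)).mono_left (by
        rw [← nhdsWithin_Ioo_eq_nhdsGT hβ]; exact nhdsWithin_mono _ Ioo_subset_Icc_self)
    simpa [hN] using this
  obtain ⟨m, hm⟩ := nonempty_Ioo.2 hβ
  -- This is the limit of `x ^ κ * u x` at `0`, written with values at an interior point.
  set c : ℂ := ((m ^ κ : ℝ) : ℂ) * u m - W m with hc
  have key : ∀ x ∈ Ioo 0 β, ((x ^ κ : ℝ) : ℂ) * u x = c + W x := by
    intro x hx
    have i1 := hGI.mono_set (sub m hm)
    have i2 := hGI.mono_set (sub x hx)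
    have := integral_eq_sub_of_locAC
      (mul_mem_locAC (contDiffOn_mem_locAC contDiffOn_rpow_ofReal) hu)
      (F := fun x => ((x ^ κ : ℝ) : ℂ) * F x) (by
        filter_upwards [h, ae_restrict_mem measurableSet_Ioo] with x hx hxI
        refine (hasDerivAt_rpow_mul (s := κ) hxI.1 hx).congr_deriv ?_
        ring) hm hx (i1.symm.trans i2)
    rw [← intervalIntegral.integral_interval_sub_left i2 i1] at this
    rw [hc]
    linear_combination -this
  -- If `c ≠ 0`, then `‖u x‖ + N β ≥ ‖c‖ x ^ (-κ) ≥ ‖c‖ x ^ (-1/2)` for small `x`, because `κ ≥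
  -- 1/2`. The right side is not square integrable at `0`, unlike the left. Cutting at `1` makes the
  -- powers comparable.
  have c0 : c = 0 := by
    by_contra hne
    have hc0 : 0 < ‖c‖ := norm_pos_iff.2 hne
    set δ := min β 1 with hδ
    have hδ0 : 0 < δ := lt_min hβ one_pos
    have hsub : Ioo 0 δ ⊆ Ioo 0 β := Ioo_subset_Ioo_right (min_le_left _ _)
    have hg : MemLp (fun x => ‖u x‖ + N β) 2 (volume.restrict (Ioo 0 δ)) :=
      (hu2.norm.mono_measure (Measure.restrict_mono hsub le_rfl)).add (memLp_const _)
    have hp : MemLp (fun x : ℝ => ‖c‖ * x ^ (-(1 / 2) : ℝ)) 2 (volume.restrict (Ioo 0 δ)) := by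
      refine hg.mono ?_ ?_
      · exact (measurable_const.mul (measurable_id.pow_const _)).aestronglyMeasurable
      · filter_upwards [ae_restrict_mem measurableSet_Ioo] with x hx
        have hxβ := hsub hx
        have hx0 := hx.1
        have hpos := Real.rpow_pos_of_pos hx0 κ
        have e1 : ‖c‖ ≤ x ^ κ * (‖u x‖ + N β) := by
          have : c = ((x ^ κ : ℝ) : ℂ) * u x - W x := by rw [key x hxβ]; ring
          calc ‖c‖ ≤ ‖((x ^ κ : ℝ) : ℂ) * u x‖ + ‖W x‖ := by rw [this]; exact norm_sub_le _ _
            _ ≤ x ^ κ * ‖u x‖ + x ^ κ * N β := by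
              refine add_le_add ?_ ((hWN x hxβ).trans
                (mul_le_mul_of_nonneg_left (hNmono x hxβ) hpos.le))
              rw [norm_mul, Complex.norm_real, Real.norm_of_nonneg hpos.le]
            _ = _ := by ring
        have e2 : x ^ (-(1 / 2) : ℝ) ≤ (x ^ κ)⁻¹ := by
          rw [← Real.rpow_neg hx0.le]
          exact Real.rpow_le_rpow_of_exponent_ge hx0 (hx.2.le.trans (min_le_right _ _))
            (by linarith)
        rw [Real.norm_of_nonneg (mul_nonneg hc0.le (Real.rpow_nonneg hx0.le _))]
        refine le_trans ?_ (le_abs_self _)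
        calc _ ≤ (x ^ κ * (‖u x‖ + N β)) * (x ^ κ)⁻¹ :=
              mul_le_mul e1 e2 (Real.rpow_nonneg hx0.le _) (hc0.le.trans e1)
          _ = _ := by field_simp
    have hsq := (hp.const_mul ‖c‖⁻¹).integrable_sq
    have : IntegrableOn (fun x : ℝ => x ^ (-1 : ℝ)) (Ioo 0 δ) := by
      refine hsq.congr ?_
      filter_upwards [ae_restrict_mem measurableSet_Ioo] with x hx
      rw [inv_mul_cancel_left₀ hc0.ne', ← Real.rpow_natCast, ← Real.rpow_mul hx.1.le]
      norm_num
    rw [intervalIntegral.integrableOn_Ioo_rpow_iff hδ0] at this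
    linarith
  -- With `c = 0`, cancelling `x ^ κ` in the bound for `W` gives `‖u x‖ ≤ N x`.
  refine squeeze_zero_norm' ?_ hN0
  filter_upwards [Ioo_mem_nhdsGT hβ] with x hx
  have hpos := Real.rpow_pos_of_pos hx.1 κ
  have e := hWN x hx
  have e' := key x hx
  rw [c0, zero_add] at e'
  rw [← e', norm_mul, Complex.norm_real, Real.norm_of_nonneg hpos.le] at e
  exact le_of_mul_le_mul_left e hpos

/-- Solutions of `v' = (κ / x) v + G` with `κ ≥ 0` and integrable `G` stay bounded at the
singular endpoint. -/
theorem isBoundedUnder_of_nonneg {β κ : ℝ} (hβ : 0 < β) (hκ : 0 ≤ κ) {v G : ℝ → ℂ}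
    (hv : v ∈ locAC (Ioo 0 β)) (hG : MemLp G 2 (volume.restrict (Ioo 0 β)))
    (h : ∀ᵐ x ∂volume.restrict (Ioo 0 β), HasDerivAt v (((κ / x : ℝ) : ℂ) * v x + G x) x) :
    IsBoundedUnder (· ≤ ·) (𝓝[>] 0) (fun x => ‖v x‖) := by
  have hGi : IntegrableOn G (Ioo 0 β) := hG.integrable (by norm_num)
  have hGI : IntervalIntegrable G volume 0 β :=
    (intervalIntegrable_iff_integrableOn_Ioo_of_le hβ.le).2 hGi
  obtain ⟨m, hm⟩ := nonempty_Ioo.2 hβ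
  refine isBoundedUnder_of_eventually_le (a := ‖v m‖ + ∫ t in (0 : ℝ)..β, ‖G t‖) ?_
  filter_upwards [Ioo_mem_nhdsGT hm.1] with x hx
  have hxβ : x ∈ Ioo 0 β := ⟨hx.1, hx.2.trans hm.2⟩
  have hpos := Real.rpow_pos_of_pos hx.1 κ
  have hsub : uIcc x m ⊆ uIcc 0 β := by
    rw [uIcc_of_le hx.2.le, uIcc_of_le hβ.le]; exact Icc_subset_Icc hx.1.le hm.2.le
  have hI := hGI.mono_set hsub
  have hcont : ContinuousOn (fun x : ℝ => ((x ^ (-κ) : ℝ) : ℂ)) (uIcc x m) := by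
    refine (contDiffOn_rpow_ofReal (β := β)).continuousOn.mono ?_
    rw [uIcc_of_le hx.2.le]
    exact fun t ht => ⟨hx.1.trans_le ht.1, ht.2.trans_lt hm.2⟩
  have key := integral_eq_sub_of_locAC
    (mul_mem_locAC (contDiffOn_mem_locAC (contDiffOn_rpow_ofReal (s := -κ))) hv)
    (F := fun x => ((x ^ (-κ) : ℝ) : ℂ) * G x) (by
      filter_upwards [h, ae_restrict_mem measurableSet_Ioo] with x hx hxI
      refine (hasDerivAt_rpow_mul (s := -κ) hxI.1 hx).congr_deriv ?_
      push_cast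
      ring) hxβ hm (hI.continuousOn_mul hcont)
  -- Since `κ ≥ 0`, the weight `t ^ (-κ)` on `[x, m]` is largest at `t = x`; this common factor
  -- cancels at the end and leaves a bound independent of `x`.
  have e1 : ‖∫ t in x..m, ((t ^ (-κ) : ℝ) : ℂ) * G t‖ ≤ x ^ (-κ) * ∫ t in (0 : ℝ)..β, ‖G t‖ := by
    have : ∫ t in x..m, ‖G t‖ ≤ ∫ t in (0 : ℝ)..β, ‖G t‖ :=
      intervalIntegral.integral_mono_interval hx.1.le hx.2.le hm.2.le
        (.of_forall fun t => norm_nonneg _) hGI.norm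
    refine le_trans ?_ (mul_le_mul_of_nonneg_left this (Real.rpow_nonneg hx.1.le _))
    rw [← intervalIntegral.integral_const_mul]
    refine intervalIntegral.norm_integral_le_of_norm_le hx.2.le (.of_forall fun t ht => ?_)
      (hI.norm.const_mul _)
    have ht0 := hx.1.trans ht.1
    rw [norm_mul, Complex.norm_real, Real.norm_of_nonneg (Real.rpow_nonneg ht0.le _)]
    exact mul_le_mul_of_nonneg_right (Real.rpow_le_rpow_of_nonpos hx.1 ht.1.le (by linarith))
      (norm_nonneg _)
  have hxp := Real.rpow_pos_of_pos hx.1 (-κ)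
  have e2 : ((x ^ (-κ) : ℝ) : ℂ) * v x = ((m ^ (-κ) : ℝ) : ℂ) * v m -
      ∫ t in x..m, ((t ^ (-κ) : ℝ) : ℂ) * G t := by rw [key]; ring
  have e3 : x ^ (-κ) * ‖v x‖ ≤ x ^ (-κ) * (‖v m‖ + ∫ t in (0 : ℝ)..β, ‖G t‖) := by
    have : x ^ (-κ) * ‖v x‖ = ‖((x ^ (-κ) : ℝ) : ℂ) * v x‖ := by
      rw [norm_mul, Complex.norm_real, Real.norm_of_nonneg hxp.le]
    rw [this, e2, mul_add]
    refine (norm_sub_le _ _).trans (add_le_add ?_ e1)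
    rw [norm_mul, Complex.norm_real, Real.norm_of_nonneg (Real.rpow_nonneg hm.1.le _)]
    exact mul_le_mul_of_nonneg_right (Real.rpow_le_rpow_of_nonpos hx.1 hx.2.le (by linarith))
      (norm_nonneg _)
  exact le_of_mul_le_mul_left e3 hxp

/-- A first order system on `(0, β)` with off-diagonal coefficient `q` and square integrable
solution and right-hand side. -/
structure IsL2Solution (β : ℝ) (q : ℝ → ℝ) (u v : ℝ → ℂ) : Prop where
  fst_mem : u ∈ locAC (Ioo 0 β)
  snd_mem : v ∈ locAC (Ioo 0 β)
  fst_memLp : MemLp u 2 (volume.restrict (Ioo 0 β))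
  snd_memLp : MemLp v 2 (volume.restrict (Ioo 0 β))
  exists_fst : ∃ F, MemLp F 2 (volume.restrict (Ioo 0 β)) ∧
    ∀ᵐ x ∂volume.restrict (Ioo 0 β), HasDerivAt u (-(q x : ℂ) * u x + F x) x
  exists_snd : ∃ G, MemLp G 2 (volume.restrict (Ioo 0 β)) ∧
    ∀ᵐ x ∂volume.restrict (Ioo 0 β), HasDerivAt v ((q x : ℂ) * v x + G x) x

theorem memLp_ofReal_mul_of_bound {μ : Measure ℝ} {b : ℝ → ℝ} {C : ℝ} {w : ℝ → ℂ}
    (hb : AEStronglyMeasurable b μ) (hC : ∀ᵐ x ∂μ, |b x| ≤ C) (hw : MemLp w 2 μ) :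
    MemLp (fun x => (b x : ℂ) * w x) 2 μ := by
  refine MemLp.of_le_mul (c := C) hw
    ((Complex.continuous_ofReal.comp_aestronglyMeasurable hb).mul hw.1) ?_
  filter_upwards [hC] with x hx
  rw [norm_mul, Complex.norm_real]
  exact mul_le_mul_of_nonneg_right hx (norm_nonneg _)

/-- The bounded part of `q` times a square integrable component is moved to the right-hand side,
leaving the pure pole `κ / x`. -/
theorem IsL2Solution.endpoint {β κ C : ℝ} (hβ : 0 < β) (hκ : 1 / 2 ≤ κ) {q : ℝ → ℝ}
    (hq : ContinuousOn q (Ioo 0 β)) (hC : ∀ x ∈ Ioo 0 β, |q x - κ / x| ≤ C) {u v : ℝ → ℂ}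
    (h : IsL2Solution β q u v) :
    Tendsto u (𝓝[>] 0) (𝓝 0) ∧ IsBoundedUnder (· ≤ ·) (𝓝[>] 0) (fun x => ‖v x‖) := by
  obtain ⟨F, hF, du⟩ := h.exists_fst
  obtain ⟨G, hG, dv⟩ := h.exists_snd
  have hm : AEStronglyMeasurable (fun x => q x - κ / x) (volume.restrict (Ioo 0 β)) :=
    (hq.sub (continuousOn_const.div continuousOn_id fun x hx => hx.1.ne')).aestronglyMeasurable
      measurableSet_Ioo
  have hb : ∀ᵐ x ∂volume.restrict (Ioo 0 β), |q x - κ / x| ≤ C := by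
    filter_upwards [ae_restrict_mem measurableSet_Ioo] with x hx using hC x hx
  constructor
  · refine tendsto_zero_of_half_le hβ hκ h.fst_mem h.fst_memLp
      (hF.sub (memLp_ofReal_mul_of_bound hm hb h.fst_memLp)) ?_
    filter_upwards [du] with x hx
    refine hx.congr_deriv ?_
    simp only [Pi.sub_apply]
    push_cast
    ring
  · refine isBoundedUnder_of_nonneg hβ (by linarith) h.snd_mem
      (hG.add (memLp_ofReal_mul_of_bound hm hb h.snd_memLp)) ?_
    filter_upwards [dv] with x hx
    refine hx.congr_deriv ?_
    simp only [Pi.add_apply]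
    push_cast
    ring

/-- This symmetry reduces negative `κ` to positive `κ`. -/
theorem IsL2Solution.swap {β : ℝ} {q : ℝ → ℝ} {u v : ℝ → ℂ} (h : IsL2Solution β q u v) :
    IsL2Solution β (fun x => -q x) v u := by
  obtain ⟨F, hF, du⟩ := h.exists_fst
  obtain ⟨G, hG, dv⟩ := h.exists_snd
  refine ⟨h.snd_mem, h.fst_mem, h.snd_memLp, h.fst_memLp, ⟨G, hG, ?_⟩, ⟨F, hF, ?_⟩⟩
  · filter_upwards [dv] with x hx
    exact hx.congr_deriv (by push_cast; ring)
  · filter_upwards [du] with x hx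
    exact hx.congr_deriv (by push_cast; ring)

theorem IsL2Solution.mono {β β' : ℝ} {q : ℝ → ℝ} {u v : ℝ → ℂ} (h : IsL2Solution β q u v)
    (hle : β' ≤ β) : IsL2Solution β' q u v := by
  have hs : Ioo 0 β' ⊆ Ioo 0 β := Ioo_subset_Ioo_right hle
  have hm : volume.restrict (Ioo 0 β') ≤ volume.restrict (Ioo 0 β) :=
    Measure.restrict_mono hs le_rfl
  obtain ⟨F, hF, du⟩ := h.exists_fst
  obtain ⟨G, hG, dv⟩ := h.exists_snd
  exact ⟨fun c d hcd hJ => h.fst_mem c d hcd (hJ.trans hs),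
    fun c d hcd hJ => h.snd_mem c d hcd (hJ.trans hs), h.fst_memLp.mono_measure hm,
    h.snd_memLp.mono_measure hm, ⟨F, hF.mono_measure hm, ae_mono hm du⟩,
    ⟨G, hG.mono_measure hm, ae_mono hm dv⟩⟩

/-- In the limit point case the boundary form vanishes at the singular endpoint. -/
theorem IsL2Solution.tendsto_boundary {β κ C : ℝ} (hβ : 0 < β) (hκ : 1 / 2 ≤ |κ|) {q : ℝ → ℝ}
    (hq : ContinuousOn q (Ioo 0 β)) (hC : ∀ x ∈ Ioo 0 β, |q x - κ / x| ≤ C) {u v u' v' : ℝ → ℂ}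
    (h : IsL2Solution β q u v) (h' : IsL2Solution β q u' v') :
    Tendsto (fun x => star (v x) * u' x - star (u x) * v' x) (𝓝[>] 0) (𝓝 0) := by
  -- Exchanging the components replaces `κ` by `-κ` and changes only the sign of the boundary form.
  wlog hpos : 0 ≤ κ generalizing κ q u v u' v'
  · have := this (κ := -κ) (by rwa [abs_neg]) hq.neg (fun x hx => ?_) h.swap h'.swap (by linarith)
    · simpa using this.neg
    · rw [neg_div, Pi.neg_apply, ← neg_sub', abs_neg]; exact hC x hx
  rw [abs_of_nonneg hpos] at hκ
  obtain ⟨u0, vb⟩ := h.endpoint hβ hκ hq hC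
  obtain ⟨u0', vb'⟩ := h'.endpoint hβ hκ hq hC
  have t1 : Tendsto (fun x => star (v x) * u' x) (𝓝[>] 0) (𝓝 0) :=
    isBoundedUnder_le_mul_tendsto_zero (f := fun x => star (v x))
      (by simpa [Function.comp_def] using vb) u0'
  have t2 : Tendsto (fun x => star (u x) * v' x) (𝓝[>] 0) (𝓝 0) := by
    have : Tendsto (fun x => star (u x)) (𝓝[>] 0) (𝓝 0) := by simpa using u0.star
    exact this.zero_mul_isBoundedUnder_le vb'
  simpa using t1.sub t2

/-! ### Reflection to the right endpoint, and self-adjointness in the limit point case. -/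

theorem const_sub_mem_Ioo {β x : ℝ} (hx : x ∈ Ioo 0 β) : β - x ∈ Ioo 0 β :=
  ⟨by linarith [hx.2], by linarith [hx.1]⟩

theorem measurePreserving_reflect (β : ℝ) :
    MeasurePreserving (fun x => β - x) (volume.restrict (Ioo 0 β)) (volume.restrict (Ioo 0 β)) := by
  have h := (Measure.measurePreserving_sub_left (volume : Measure ℝ) β).restrict_preimage
    (measurableSet_Ioo (a := 0) (b := β))
  simpa using h

/-- By the fundamental theorem the reflected function is `u m` minus a primitive of `g (β - ·)`
based at `β - m`, and primitives are locally absolutely continuous. -/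
theorem reflect_mem_locAC {β : ℝ} (hβ : 0 < β) {u g : ℝ → ℂ} (hu : u ∈ locAC (Ioo 0 β))
    (hg : LocallyIntegrableOn g (Ioo 0 β))
    (h : ∀ᵐ x ∂volume.restrict (Ioo 0 β), HasDerivAt u (g x) x) :
    (fun x => u (β - x)) ∈ locAC (Ioo 0 β) := by
  have hg' : LocallyIntegrableOn (fun x => g (β - x)) (Ioo 0 β) := by
    rw [locallyIntegrableOn_iff isOpen_Ioo.isLocallyClosed] at hg ⊢
    intro K hK hKc
    have hc : IsCompact ((fun x => β - x) ⁻¹' K) :=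
      ((Homeomorph.subLeft β).isCompact_preimage).2 hKc
    have h1 := hg _ (fun x hx => by
      have := const_sub_mem_Ioo (hK hx)
      rwa [sub_sub_cancel] at this) hc
    have h2 := ((Measure.measurePreserving_sub_left
      (volume : Measure ℝ) β).integrableOn_comp_preimage
      (Homeomorph.subLeft β).measurableEmbedding (s := (fun x => β - x) ⁻¹' K) (f := g)).2 h1
    rw [← preimage_comp] at h2
    simpa [Function.comp_def] using h2
  obtain ⟨m, hm⟩ := nonempty_Ioo.2 hβ
  refine mem_locAC_of_eqOn ((locAC _).sub_mem
    (contDiffOn_mem_locAC (contDiffOn_const (c := u m)))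
    (primitive_mem_locAC (const_sub_mem_Ioo hm) hg')) fun x hx => ?_
  have hx' := const_sub_mem_Ioo hx
  have := integral_eq_sub_of_locAC hu h hm hx'
    (intervalIntegrable_of_locallyIntegrableOn_Ioo hg hm hx')
  simp only [Pi.sub_apply]
  rw [intervalIntegral.integral_comp_sub_left, sub_sub_cancel, intervalIntegral.integral_symm, this]
  ring

theorem ae_hasDerivAt_reflect {β : ℝ} {u g : ℝ → ℂ}
    (h : ∀ᵐ x ∂volume.restrict (Ioo 0 β), HasDerivAt u (g x) x) :
    ∀ᵐ x ∂volume.restrict (Ioo 0 β), HasDerivAt (fun x => u (β - x)) (-g (β - x)) x := by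
  filter_upwards [(measurePreserving_reflect β).quasiMeasurePreserving.ae h] with x hx
  exact hx.comp_const_sub β x

/-- Reflection reverses the sign of derivatives. Exchanging the components compensates for this, so
the coefficient is reflected without a change of sign. -/
theorem IsL2Solution.reflect {β : ℝ} (hβ : 0 < β) {q : ℝ → ℝ} (hq : ContinuousOn q (Ioo 0 β))
    {u v : ℝ → ℂ} (h : IsL2Solution β q u v) :
    IsL2Solution β (fun x => q (β - x)) (fun x => v (β - x)) (fun x => u (β - x)) := by
  obtain ⟨F, hF, du⟩ := h.exists_fst
  obtain ⟨G, hG, dv⟩ := h.exists_snd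
  have mp := measurePreserving_reflect β
  have li : ∀ {w : ℝ → ℂ}, MemLp w 2 (volume.restrict (Ioo 0 β)) →
      LocallyIntegrableOn w (Ioo 0 β) := fun hw =>
    IntegrableOn.locallyIntegrableOn (hw.integrable (by norm_num))
  refine ⟨reflect_mem_locAC hβ h.snd_mem ((locallyIntegrableOn_ofReal_mul isOpen_Ioo hq
      (li h.snd_memLp)).add (li hG)) dv,
    reflect_mem_locAC hβ h.fst_mem ((locallyIntegrableOn_ofReal_mul isOpen_Ioo hq
      (li h.fst_memLp)).neg.add (li hF)) ?_,
    h.snd_memLp.comp_measurePreserving mp, h.fst_memLp.comp_measurePreserving mp,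
    ⟨fun x => -G (β - x), (hG.comp_measurePreserving mp).neg, ?_⟩,
    ⟨fun x => -F (β - x), (hF.comp_measurePreserving mp).neg, ?_⟩⟩
  · filter_upwards [du] with x hx
    exact hx.congr_deriv (by simp)
  · filter_upwards [ae_hasDerivAt_reflect dv] with x hx
    exact hx.congr_deriv (by ring)
  · filter_upwards [ae_hasDerivAt_reflect du] with x hx
    exact hx.congr_deriv (by ring)

theorem abs_diag_le (x : ℝ) : |diag Λ a mₑ x| ≤ |a * mₑ| := by
  rw [diag, abs_mul]
  exact mul_le_of_le_one_right (abs_nonneg _) (Real.abs_cos_le_one _)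

theorem aestronglyMeasurable_diag (hΛ : 0 < Λ) :
    AEStronglyMeasurable (diag Λ a mₑ) (volume.restrict (I Λ a)) :=
  (continuousOn_diag hΛ).aestronglyMeasurable measurableSet_Ioo

theorem memLp_diag_mul (hΛ : 0 < Λ) {w : ℝ → ℂ} (hw : MemLp w 2 (volume.restrict (I Λ a))) :
    MemLp (fun x => (diag Λ a mₑ x : ℂ) * w x) 2 (volume.restrict (I Λ a)) :=
  memLp_ofReal_mul_of_bound (aestronglyMeasurable_diag hΛ) (.of_forall abs_diag_le) hw

/-- The bounded diagonal terms are treated as part of the square integrable right-hand sides, which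
decouples the two equations. -/
theorem IsRep.isL2Solution (hΛ : 0 < Λ) {p : L2I2 Λ a × L2I2 Λ a} {u v : ℝ → ℂ}
    (hu : u ∈ locAC (I Λ a)) (hv : v ∈ locAC (I Λ a)) (hp : IsRep Λ a mₑ ω k p u v) :
    IsL2Solution (xCoord Λ a Real.pi) (offDiag Λ a ω k) u v := by
  have mu := (memLp_congr_ae hp.1).1 (Lp.memLp _)
  have mv := (memLp_congr_ae hp.2.1).1 (Lp.memLp _)
  have m1 := (memLp_congr_ae hp.2.2.1).1 (Lp.memLp _)
  have m2 := (memLp_congr_ae hp.2.2.2).1 (Lp.memLp _)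
  refine ⟨hu, hv, mu, mv, ⟨_, (memLp_diag_mul (mₑ := mₑ) hΛ mv).sub m2, ?_⟩,
    ⟨_, m1.add (memLp_diag_mul (mₑ := mₑ) hΛ mu), ?_⟩⟩
  · filter_upwards [locAC_ae_differentiableAt hu] with x hx
    refine hx.hasDerivAt.congr_deriv ?_
    simp only [Pi.sub_apply, diracSnd]
    ring
  · filter_upwards [locAC_ae_differentiableAt hv] with x hx
    refine hx.hasDerivAt.congr_deriv ?_
    simp only [Pi.add_apply, diracFst]
    ring

/-- On half the interval the far pole is bounded, so each end shows a single pole with the same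
residue. -/
theorem offDiag_bound_half (hΛ : 0 < Λ) (a ω k : ℝ) : ∃ C,
    ∀ x ∈ Ioo 0 (xCoord Λ a Real.pi / 2), |offDiag Λ a ω k x - (k + 1 / 2) / x| ≤ C ∧
      |offDiag Λ a ω k (xCoord Λ a Real.pi - x) - (k + 1 / 2) / x| ≤ C := by
  obtain ⟨C, hC⟩ := exists_offDiag_bound hΛ a ω k
  set X := xCoord Λ a Real.pi with hX
  have hX0 : 0 < X := xCoord_pi_pos hΛ
  refine ⟨C + |k + 1 / 2| / (X / 2), fun x hx => ?_⟩
  have hxI : x ∈ Ioo 0 X := ⟨hx.1, by linarith [hx.2]⟩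
  have hb : |(k + 1 / 2) / (X - x)| ≤ |k + 1 / 2| / (X / 2) := by
    rw [abs_div, abs_of_pos (by linarith [hxI.2] : 0 < X - x)]
    exact div_le_div_of_nonneg_left (abs_nonneg _) (by positivity) (by linarith [hx.2])
  have h1 := hC x hxI
  have h2 := hC (X - x) (const_sub_mem_Ioo hxI)
  rw [sub_sub_cancel] at h2
  rw [abs_le] at hb h1 h2
  constructor <;> rw [abs_le] <;> constructor <;> linarith [h1.1, h1.2, h2.1, h2.2, hb.1, hb.2]

theorem isSelfAdjoint_angularOp_of_half_le (hΛ : 0 < Λ) (hk : 1 / 2 ≤ |k + 1 / 2|) :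
    IsSelfAdjoint (angularOp Λ a mₑ ω k) := by
  rw [isSelfAdjoint_angularOp_iff hΛ]
  rintro p ⟨u, hu, v, hv, hp⟩ p' ⟨u', hu', v', hv', hp'⟩
  have hX := xCoord_pi_pos (a := a) hΛ
  have hq := continuousOn_offDiag (a := a) (ω := ω) (k := k) hΛ
  obtain ⟨C, hC⟩ := offDiag_bound_half hΛ a ω k
  have s := IsRep.isL2Solution hΛ hu hv hp
  have s' := IsRep.isL2Solution hΛ hu' hv' hp'
  set X := xCoord Λ a Real.pi
  have hX2 : 0 < X / 2 := by positivity
  have hle : X / 2 ≤ X := by linarith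
  have hsub : Ioo 0 (X / 2) ⊆ Ioo 0 X := Ioo_subset_Ioo_right hle
  have tl := (s.mono hle).tendsto_boundary hX2 hk (hq.mono hsub) (fun x hx => (hC x hx).1)
    (s'.mono hle)
  have hq' : ContinuousOn (fun x => offDiag Λ a ω k (X - x)) (Ioo 0 (X / 2)) :=
    hq.comp (continuousOn_const.sub continuousOn_id) fun x hx => const_sub_mem_Ioo (hsub hx)
  have tr := ((s.reflect hX hq).mono hle).tendsto_boundary hX2 hk hq' (fun x hx => (hC x hx).2)
    ((s'.reflect hX hq).mono hle)
  have hX' : Tendsto (fun x => X - x) (𝓝[<] X) (𝓝[>] 0) := by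
    refine tendsto_nhdsWithin_iff.2 ⟨?_, ?_⟩
    · have : Tendsto (fun x => X - x) (𝓝 X) (𝓝 (X - X)) :=
        (continuous_const.sub continuous_id).tendsto X
      rw [sub_self] at this
      exact this.mono_left nhdsWithin_le_nhds
    · filter_upwards [self_mem_nhdsWithin] with x hx using sub_pos.2 (mem_Iio.1 hx)
  -- The sign comes from the exchange of components in the reflection.
  have tr' := (tr.comp hX').neg
  rw [inner_sub_inner_eq hΛ hu hv hu' hv' hp hp' tl (r := 0) (by
    simpa [Function.comp_def, X] using tr'), sub_zero]

/-! ### The limit circle case -/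

theorem memLp_rpow {s β : ℝ} (hβ : 0 < β) (hs : -(1 / 2) < s) :
    MemLp (fun x : ℝ => ((x ^ s : ℝ) : ℂ)) 2 (volume.restrict (Ioo 0 β)) := by
  have hm : AEStronglyMeasurable (fun x : ℝ => ((x ^ s : ℝ) : ℂ)) (volume.restrict (Ioo 0 β)) :=
    (Complex.measurable_ofReal.comp (measurable_id.pow_const s)).aestronglyMeasurable
  rw [memLp_two_iff_integrable_sq_norm hm]
  refine ((intervalIntegral.integrableOn_Ioo_rpow_iff (s := s * 2) hβ).2 (by linarith)).congr ?_
  filter_upwards [ae_restrict_mem measurableSet_Ioo] with x hx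
  rw [Complex.norm_real, Real.norm_of_nonneg (Real.rpow_nonneg hx.1.le _), ← Real.rpow_natCast,
    ← Real.rpow_mul hx.1.le]
  norm_num

/-- The model solution `(β - x) x ^ s`. -/
noncomputable def powerSol (β s : ℝ) (x : ℝ) : ℂ := ((x ^ s : ℝ) : ℂ) * ((β - x : ℝ) : ℂ)

theorem powerSol_mem_locAC (β s : ℝ) : powerSol β s ∈ locAC (Ioo 0 β) :=
  mul_mem_locAC (contDiffOn_mem_locAC contDiffOn_rpow_ofReal) (contDiffOn_mem_locAC
    (Complex.ofRealCLM.contDiff.comp (contDiff_const.sub contDiff_id)).contDiffOn)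

theorem hasDerivAt_powerSol {β s x : ℝ} (hx : 0 < x) :
    HasDerivAt (powerSol β s)
      (((x ^ s : ℝ) : ℂ) * (-1 + ((s / x : ℝ) : ℂ) * ((β - x : ℝ) : ℂ))) x := by
  refine hasDerivAt_rpow_mul hx ?_
  have : HasDerivAt (fun x => β - x) (-1) x := (hasDerivAt_id x).const_sub β
  simpa using this.ofReal_comp

theorem memLp_powerSol {β s : ℝ} (hβ : 0 < β) (hs : -(1 / 2) < s) :
    MemLp (powerSol β s) 2 (volume.restrict (Ioo 0 β)) := by
  have := memLp_ofReal_mul_of_bound (b := fun x => β - x) (C := β)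
    (measurable_const.sub measurable_id).aestronglyMeasurable (by
      filter_upwards [ae_restrict_mem measurableSet_Ioo] with x hx
      rw [abs_le]; constructor <;> linarith [hx.1, hx.2]) (memLp_rpow hβ hs)
  refine (memLp_congr_ae (.of_forall fun x => ?_)).1 this
  rw [powerSol, mul_comm]

/-- For `c` equal to its two pole terms the expression is exactly `-(1 + s) x ^ s`: the factor `β -
x` in `powerSol` removes the pole at `β`. The bounded error of `c` adds a bounded multiple of `x ^
s`, which is square integrable for `s > -1/2`. -/
theorem memLp_deriv_powerSol_sub {β s C : ℝ} (hβ : 0 < β) (hs : -(1 / 2) < s) {c : ℝ → ℝ}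
    (hc : ContinuousOn c (Ioo 0 β)) (hC : ∀ x ∈ Ioo 0 β, |c x - (s / x + s / (β - x))| ≤ C) :
    MemLp (fun x => deriv (powerSol β s) x - (c x : ℂ) * powerSol β s x) 2
      (volume.restrict (Ioo 0 β)) := by
  set b : ℝ → ℝ := fun x => -1 - s - (β - x) * (c x - (s / x + s / (β - x))) with hb
  have hbm : AEStronglyMeasurable b (volume.restrict (Ioo 0 β)) := by
    refine ContinuousOn.aestronglyMeasurable ?_ measurableSet_Ioo
    refine continuousOn_const.sub ((continuousOn_const.sub continuousOn_id).mul (hc.sub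
      ((continuousOn_const.div continuousOn_id fun x hx => hx.1.ne').add
        (continuousOn_const.div (continuousOn_const.sub continuousOn_id)
          fun x hx => (sub_pos.2 hx.2).ne'))))
  have hbb : ∀ᵐ x ∂volume.restrict (Ioo 0 β), |b x| ≤ |-1 - s| + β * C := by
    filter_upwards [ae_restrict_mem measurableSet_Ioo] with x hx
    refine (abs_sub _ _).trans (add_le_add le_rfl ?_)
    rw [abs_mul]
    refine mul_le_mul ?_ (hC x hx) (abs_nonneg _) hβ.le
    rw [abs_le]; constructor <;> linarith [hx.1, hx.2]
  refine (memLp_congr_ae ?_).1 (memLp_ofReal_mul_of_bound hbm hbb (memLp_rpow hβ hs))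
  filter_upwards [ae_restrict_mem measurableSet_Ioo] with x hx
  rw [(hasDerivAt_powerSol hx.1).deriv, powerSol]
  have h0 : (x : ℝ) ≠ 0 := hx.1.ne'
  have h1 : β - x ≠ 0 := (sub_pos.2 hx.2).ne'
  have e : b x = -1 + s / x * (β - x) - c x * (β - x) := by
    simp only [hb]; field_simp; ring
  rw [e]
  push_cast
  ring

/-- For `|κ| < 1/2` both `(powerSol X (-κ), 0)` and `(0, powerSol X κ)` lie in the domain. The
powers cancel in their boundary form `-(X - x)²`, which tends to `0` at `X` but to `-X² ≠ 0` at `0`,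
so symmetry fails. -/
theorem not_isSelfAdjoint_angularOp (hΛ : 0 < Λ) (hk : |k + 1 / 2| < 1 / 2) :
    ¬ IsSelfAdjoint (angularOp Λ a mₑ ω k) := by
  rw [isSelfAdjoint_angularOp_iff hΛ]
  intro h
  have hX := xCoord_pi_pos (a := a) hΛ
  have hq := continuousOn_offDiag (a := a) (ω := ω) (k := k) hΛ
  obtain ⟨C, hC⟩ := exists_offDiag_bound hΛ a ω k
  set X := xCoord Λ a Real.pi with hXdef
  set κ := k + 1 / 2 with hκ
  rw [abs_lt] at hk
  have mu := memLp_powerSol (s := -κ) hX (by linarith)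
  have mv := memLp_powerSol (s := κ) hX (by linarith)
  -- The first component enters `𝒰` through `-u' - q u`, so the coefficient is `-q`, with residues
  -- `-κ`.
  have mu' := memLp_deriv_powerSol_sub (s := -κ) (C := C) hX (by linarith) hq.neg fun x hx => by
    have := hC x hx
    rw [← abs_neg] at this
    convert this using 2
    simp only [Pi.neg_apply]
    ring
  have mv' := memLp_deriv_powerSol_sub (s := κ) hX (by linarith) hq hC
  have hu : powerSol X (-κ) ∈ locAC (I Λ a) := powerSol_mem_locAC X (-κ)
  have hv : powerSol X κ ∈ locAC (I Λ a) := powerSol_mem_locAC X κ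
  have h0 : (0 : ℝ → ℂ) ∈ locAC (I Λ a) := Submodule.zero_mem _
  have d0 : ∀ x, deriv (0 : ℝ → ℂ) x = 0 := fun x => deriv_const x 0
  obtain ⟨p, hp⟩ := exists_isRep (mₑ := mₑ) (ω := ω) (k := k) mu MemLp.zero
    ((memLp_congr_ae (.of_forall fun x => by simp [diracFst, d0])).1
      (memLp_diag_mul (mₑ := mₑ) hΛ mu).neg)
    ((memLp_congr_ae (.of_forall fun x => by simp [diracSnd]; ring)).1 mu'.neg)
  obtain ⟨p', hp'⟩ := exists_isRep (mₑ := mₑ) (ω := ω) (k := k) MemLp.zero mv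
    ((memLp_congr_ae (.of_forall fun x => by simp [diracFst])).1 mv')
    ((memLp_congr_ae (.of_forall fun x => by simp [diracSnd, d0])).1
      (memLp_diag_mul (mₑ := mₑ) hΛ mv))
  have e : ∀ x ∈ Ioo 0 X, -(((X - x : ℝ) : ℂ)) ^ 2 =
      star ((0 : ℝ → ℂ) x) * (0 : ℝ → ℂ) x - star (powerSol X (-κ) x) * powerSol X κ x := by
    intro x hx
    have : ((x ^ (-κ) : ℝ) : ℂ) * ((x ^ κ : ℝ) : ℂ) = 1 := by
      rw [← Complex.ofReal_mul, ← Real.rpow_add hx.1]; simp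
    simp only [powerSol, star_mul', Complex.star_def, Complex.conj_ofReal, Pi.zero_apply]
    linear_combination (((X - x : ℝ) : ℂ)) ^ 2 * this
  have hc : Continuous fun x : ℝ => -(((X - x : ℝ) : ℂ)) ^ 2 := by fun_prop
  have := inner_sub_inner_eq hΛ hu h0 h0 hv hp hp'
    (((hc.tendsto 0).mono_left nhdsWithin_le_nhds).congr' (by
      filter_upwards [Ioo_mem_nhdsGT hX] with x hx using e x hx))
    (((hc.tendsto X).mono_left nhdsWithin_le_nhds).congr' (by
      filter_upwards [Ioo_mem_nhdsLT hX] with x hx using e x hx))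
  rw [h p ⟨_, hu, _, h0, hp⟩ p' ⟨_, h0, _, hv, hp'⟩] at this
  have : (X : ℂ) = 0 := by simpa using this.symm
  exact hX.ne' (Complex.ofReal_eq_zero.1 this)

/-! ### The criterion in terms of `k`. -/

theorem half_le_abs_iff (k : ℝ) :
    1 / 2 ≤ |k + 1 / 2| ↔ k ∈ (Set.univ : Set ℝ) \ Set.Ioo (-1) 0 := by
  rw [← not_lt, abs_lt, Set.mem_sdiff, mem_Ioo]
  constructor
  · exact fun h => ⟨mem_univ _, fun h' => h ⟨by linarith [h'.1], by linarith [h'.2]⟩⟩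
  · exact fun h h' => h.2 ⟨by linarith [h'.1], by linarith [h'.2]⟩

theorem isSelfAdjoint_angularOp_iff_mem (hΛ : 0 < Λ) :
    IsSelfAdjoint (angularOp Λ a mₑ ω k) ↔ k ∈ (Set.univ : Set ℝ) \ Set.Ioo (-1) 0 := by
  rw [← half_le_abs_iff]
  exact ⟨fun h => not_lt.1 fun hlt => not_isSelfAdjoint_angularOp hΛ hlt h,
    isSelfAdjoint_angularOp_of_half_le hΛ⟩

end KerrDeSitter

theorem mainTheorem1 (Λ a mₑ ω : ℝ) (hΛ : 0 < Λ) :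
    (∀ k : ℝ, IsSelfAdjoint (KerrDeSitter.angularOp Λ a mₑ ω k) ↔
      k ∈ (Set.univ : Set ℝ) \ Set.Ioo (-1) 0) ∧
    (∀ n : ℤ, IsSelfAdjoint (KerrDeSitter.angularOp Λ a mₑ ω n)) ∧
    (∀ k : ℝ, IsSelfAdjoint (KerrDeSitter.angularOp Λ a mₑ ω k) →
      (KerrDeSitter.angularMin Λ a mₑ ω k).IsClosable ∧
      KerrDeSitter.angularOp Λ a mₑ ω k = (KerrDeSitter.angularMin Λ a mₑ ω k).closure) := by
  refine ⟨fun k => KerrDeSitter.isSelfAdjoint_angularOp_iff_mem hΛ, fun n => ?_,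
    fun k hk => KerrDeSitter.closure_angularMin hΛ hk⟩
  rw [KerrDeSitter.isSelfAdjoint_angularOp_iff_mem hΛ]
  refine ⟨Set.mem_univ _, fun h => ?_⟩
  have h1 : -1 < n := by exact_mod_cast h.1
  have h2 : n < 0 := by exact_mod_cast h.2
  lia
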